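/- Let $m\ge 1$ and $\sigma>0$. For an unknown real sequence $\theta=(\theta_{jk})_{j\ge 0,\,1\le k\le 2^j}$, machine $i\in\{1,\dots,m\}$ observes $X_i=(X_{i,jk})$ with $X_{i,jk}=\theta_{jk}+\sigma z_{i,jk}$, where the $z_{i,jk}$ are i.i.d. $N(0,1)$. A distributed estimator $\hat\theta$ consists of transcripts $Z_1,\dots,Z_m$ and an estimate $\hat\theta=\hat\theta(Z_1,\dots,Z_m)$: from $X_i$ and private randomness alone, machine $i$ produces a bit string $Z_i$ that is a codeword of a fixed uniquely decodable code (in particular non-empty), and the estimate is a (possibly randomized) function of the transcripts with values in the real sequences. Put $\|\hat\theta-\theta\|^2=\sum_{j,k}(\hat\theta_{jk}-\theta_{jk})^2$ and let $L(\hat\theta)=\sum_{i=1}^m|Z_i|$ be the total length of the transcripts. For $\alpha>0$, $M>0$, $0<p,q\le\infty$ with $\alpha+\frac12-\frac1p>0$ let $$\mathcal B^{\alpha}_{p,q}(M)=\Big\{\theta:\Big(\sum_{j\ge 0}\Big(2^{j(\alpha+1/2-1/p)}\Big(\sum_{k=1}^{2^j}|\theta_{jk}|^p\Big)^{1/p}\Big)^q\Big)^{1/q}\le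 M\Big\},$$ with suprema in place of the sums when $p=\infty$ or $q=\infty$. **Theorem.** For all $C,\alpha_1,\alpha_2>0$ there is a constant $c>0$, depending only on $C,\alpha_1,\alpha_2$, such that the following holds for all $m\ge1$, $\sigma,M_1,M_2>0$, all $p_l,q_l\in(0,\infty]$ with $\alpha_l+\frac12-\frac1{p_l}>0$ ($l=1,2$), and every distributed estimator $\hat\theta$. If $M_1\le C\sigma m^{2\alpha_1+\frac12}$ and $$\sup_{\theta\in\mathcal B^{\alpha_l}_{p_l,q_l}(M_l)}\mathbb E_\theta\|\hat\theta-\theta\|^2\le C\,M_l^{\frac{2}{2\alpha_l+1}}\Big(\frac{\sigma^2}{m}\Big)^{\frac{2\alpha_l}{2\alpha_l+1}}\qquad\text{for } l=1,2,$$ then $$\sup_{\theta\in\mathcal B^{\alpha_2}_{p_2,q_2}(M_2)}\mathbb E_\theta L(\hat\theta)\ \ge\ c\left(\Big(\frac{M_1}{\sigma}\Big)^{\frac{2}{2\alpha_1+1}}m^{\frac{2\alpha_1+2}{2\alpha_1+1}}+\Big(\frac{M_2}{\sigma}\Big)^{\frac{2}{2\alpha_2+1}}m^{\frac{2\alpha_2+2}{2\alpha_2+1}}\right).$$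 -/

import Mathlib

open MeasureTheory ProbabilityTheory
open scoped ENNReal

namespace DistributedSequence

/-- Positions `(j, k)` of the coefficients: level `j = 0, 1, 2, …`, and `2 ^ j` coefficients at
level `j` (numbered from `0`). -/
abbrev Idx : Type := Σ j : ℕ, Fin (2 ^ j)

/-- Real coefficient sequences `(θ_{jk})`, with the product σ-algebra. -/
abbrev Coeff : Type := Idx → ℝ

/-- The `ℓ_p` (quasi-)norm, `0 < p ≤ ∞`, of a family of numbers in `[0, ∞]`. -/
noncomputable def ellNorm {ι : Type} (p : ℝ≥0∞) (a : ι → ℝ≥0∞) : ℝ≥0∞ :=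
  if p = ∞ then ⨆ i, a i else (∑' i, a i ^ p.toReal) ^ (1 / p.toReal)

/-- The exponent `s = α + 1/2 - 1/p`, where `1/p = 0` if `p = ∞`. -/
noncomputable def besovExponent (α : ℝ) (p : ℝ≥0∞) : ℝ := α + 1 / 2 - (p⁻¹).toReal

/-- The Besov sequence norm: the `ℓ_q` norm over the levels `j` of
`2 ^ (j s)` times the `ℓ_p` norm of the coefficients of level `j`. -/
noncomputable def besovNorm (α : ℝ) (p q : ℝ≥0∞) (θ : Coeff) : ℝ≥0∞ :=
  ellNorm q fun j : ℕ =>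
    ENNReal.ofReal ((2 : ℝ) ^ ((j : ℝ) * besovExponent α p)) *
      ellNorm p fun k : Fin (2 ^ j) => ENNReal.ofReal |θ ⟨j, k⟩|

/-- The Besov class: sequences of Besov norm at most `M`. -/
def besovClass (α : ℝ) (p q : ℝ≥0∞) (M : ℝ) : Set Coeff :=
  {θ | besovNorm α p q θ ≤ ENNReal.ofReal M}

/-- The law of the observation on one machine: independent coordinates
`X_{jk} = θ_{jk} + σ z_{jk}` with standard normal `z_{jk}`. -/
noncomputable def observationLaw (σ : ℝ) (θ : Coeff) : Measure Coeff :=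
  Measure.infinitePi fun i : Idx => gaussianReal (θ i) (Real.toNNReal (σ ^ 2))

/-- Bit strings carry the discrete σ-algebra. -/
instance : MeasurableSpace (List Bool) := ⊤

/-- A distributed estimator on `m` machines (independent protocol). From its own observation and
private randomness, machine `i` produces a bit string, a codeword of a fixed uniquely decodable
code (so it is never empty); the centre turns the `m` strings, and possibly further
randomness, into an estimate. Randomized maps are Markov kernels. -/
structure DistributedEstimator (m : ℕ) where
  /-- The code used by each machine. -/
  code : Fin m → Set (List Bool)
  uniquelyDecodable : ∀ i, InformationTheory.UniquelyDecodable (code i)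
  /-- The conditional law of the transcript of machine `i`, given the observation there. -/
  transcript : Fin m → Kernel Coeff (List Bool)
  isMarkovKernel_transcript : ∀ i, IsMarkovKernel (transcript i)
  transcript_mem_code : ∀ i x, ∀ᵐ z ∂(transcript i x), z ∈ code i
  /-- The conditional law of the estimate, given all the transcripts. -/
  estimate : Kernel (Fin m → List Bool) Coeff
  isMarkovKernel_estimate : IsMarkovKernel estimate

namespace DistributedEstimator

variable {m : ℕ}

/-- The joint law of the transcripts `(Z_1, …, Z_m)` when the true sequence is `θ`. The
observations are i.i.d. and each transcript uses only the observation on its machine and private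
randomness, so this is the product of the marginal laws. -/
noncomputable def transcriptLaw (T : DistributedEstimator m) (σ : ℝ) (θ : Coeff) :
    Measure (Fin m → List Bool) :=
  Measure.pi fun i => (observationLaw σ θ).bind (T.transcript i)

/-- The law of the estimate when the true sequence is `θ`. -/
noncomputable def estimateLaw (T : DistributedEstimator m) (σ : ℝ) (θ : Coeff) :
    Measure Coeff :=
  (T.transcriptLaw σ θ).bind T.estimate

/-- The mean squared error `E_θ ‖θhat - θ‖²`, a number in `[0, ∞]`. -/
noncomputable def risk (T : DistributedEstimator m) (σ : ℝ) (θ : Coeff) : ℝ≥0∞ :=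
  ∫⁻ t, ∑' i : Idx, ENNReal.ofReal ((t i - θ i) ^ 2) ∂(T.estimateLaw σ θ)

/-- The expected total length `E_θ L = E_θ (|Z_1| + ⋯ + |Z_m|)` of the transcripts. -/
noncomputable def expectedCommunication (T : DistributedEstimator m) (σ : ℝ) (θ : Coeff) :
    ℝ≥0∞ :=
  ∫⁻ z, ∑ i : Fin m, ((z i).length : ℝ≥0∞) ∂(T.transcriptLaw σ θ)

end DistributedEstimator

/-- The centralized optimal rate `M ^ (2/(2α+1)) (σ²/m) ^ (2α/(2α+1))`. -/
noncomputable def centralizedRate (α M σ : ℝ) (m : ℕ) : ℝ :=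
  M ^ (2 / (2 * α + 1)) * (σ ^ 2 / (m : ℝ)) ^ (2 * α / (2 * α + 1))

/-- The communication rate `(M/σ) ^ (2/(2α+1)) m ^ ((2α+2)/(2α+1))`. -/
noncomputable def communicationRate (α M σ : ℝ) (m : ℕ) : ℝ :=
  (M / σ) ^ (2 / (2 * α + 1)) * (m : ℝ) ^ ((2 * α + 2) / (2 * α + 1))

end DistributedSequence

/-!
Write `D = (M² m / σ²) ^ (1 / (2α + 1))` (`effectiveDim`). The centralized rate is `D σ² / m`, the
rate at which each of about `D` coefficients is estimated with variance `σ² / m`, and the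
communication rate is `D m`: every machine has to spend about `D` bits. If `D` is bounded this holds
because codewords are non-empty (`machines_le_expectedCommunication`). Otherwise consider the cube
of sequences with entries `± δ` on one level `j` and zero elsewhere, where `2 ^ j` is a small
multiple of `D` and `δ² = β σ² / m` with a large constant `β`, as large as the Besov class allows
(`vertex_level_mem_besovClass`). Then `C D σ² / m` is a small fraction of `2 ^ j δ²`, so a rate
optimal estimator recovers most signs.

*Need for information.* By Le Cam's two-point bound along the edges of the cube and the
tensorization of the Hellinger affinity over the machines, the squared Hellinger distances between
the transcript laws at the two ends of an edge, summed over machines and coordinates and averaged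
over the vertices, are at least of order `2 ^ j` (`le_sum_hellingerPos_of_risk_le`).

*Supply of information.* Fix a vertex and a machine, and let `ℓ_k` be the likelihood ratio for the
flip of the sign `k`. Under the law at that vertex the variables `1 - ℓ_k` are independent and
centred, with a Gaussian *upper* tail of variance proxy of order `(δ / σ)² = β / m`
(`integral_exp_one_sub_gaussianLR_le`). It suffices to control the part of the Hellinger distance
where the probability of a word `z` at the vertex is the larger one (`hellingerPos`), and there only
the upper tail of `1 - ℓ_k` matters: the entropy inequality bounds the sum over `k` of the squared
positive parts of `E[1 - ℓ_k | z]` by a multiple of `(β / m) log (1 / P(z))`, hence by the codelength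
`|z|` and Kraft's inequality (`sum_sq_condMean_le`). Words longer than a small multiple of `2 ^ j`
contribute at most about `(β / m) 2 ^ j` times their probability (`condMean_sq_le`). Comparing with
the need, words of length at least of order `D` have probability bounded below, on average over
machines and vertices (`le_sum_prob_long_of_risk_le`, `exists_cube_of_minimax`).

For the class on which the communication is measured, Markov's inequality at one vertex of the cube
finishes. For the other class, the `χ²`-divergence between the mixture of the observation laws over
the vertices and the law at the zero sequence is, on one machine, controlled by
`2 ^ j (δ / σ)⁴ ≲ D / m²`, which is bounded precisely because `M ≤ C σ m ^ (2α + 1/2)`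
(`sum_vertex_prob_le`). Hence long words are also frequent at the zero sequence, which belongs to
every Besov class.
-/

namespace DistributedSequence

/-! ### Overlap of product distributions -/

theorem one_sub_sum_le_prod_one_sub {ι : Type*} (s : Finset ι) (x : ι → ℝ)
    (h0 : ∀ i ∈ s, 0 ≤ x i) (h1 : ∀ i ∈ s, x i ≤ 1) :
    1 - ∑ i ∈ s, x i ≤ ∏ i ∈ s, (1 - x i) := by
  classical
  induction s using Finset.induction_on with
  | empty => simp
  | insert a s ha ih =>
    rw [Finset.sum_insert ha, Finset.prod_insert ha]
    have h2 := ih (fun i hi => h0 i (Finset.mem_insert_of_mem hi))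
      (fun i hi => h1 i (Finset.mem_insert_of_mem hi))
    have h3 := h0 a (Finset.mem_insert_self _ _)
    have h4 := h1 a (Finset.mem_insert_self _ _)
    have h5 : 0 ≤ ∑ i ∈ s, x i :=
      Finset.sum_nonneg fun i hi => h0 i (Finset.mem_insert_of_mem hi)
    nlinarith [mul_le_mul_of_nonneg_left h2 (sub_nonneg.2 h4)]

/-- Le Cam's inequality between the overlap `∑ min(P, Q)` and the Bhattacharyya affinity. -/
theorem sq_sum_sqrt_mul_le {β : Type*} (S : Finset β) (P Q : β → ℝ)
    (hP : ∀ z, 0 ≤ P z) (hQ : ∀ z, 0 ≤ Q z) (hP1 : ∑ z ∈ S, P z ≤ 1) (hQ1 : ∑ z ∈ S, Q z ≤ 1) :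
    (∑ z ∈ S, √(P z * Q z)) ^ 2 ≤ 2 * ∑ z ∈ S, min (P z) (Q z) := by
  have h1 : ∀ z, √(P z * Q z) = √(min (P z) (Q z)) * √(max (P z) (Q z)) := fun z => by
    rw [← Real.sqrt_mul (le_min (hP z) (hQ z)), min_mul_max]
  simp_rw [h1]
  refine (Finset.sum_mul_sq_le_sq_mul_sq S _ _).trans ?_
  have h2 : ∑ z ∈ S, √(min (P z) (Q z)) ^ 2 = ∑ z ∈ S, min (P z) (Q z) :=
    Finset.sum_congr rfl fun z _ => Real.sq_sqrt (le_min (hP z) (hQ z))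
  have h3 : ∑ z ∈ S, √(max (P z) (Q z)) ^ 2 ≤ 2 := by
    calc ∑ z ∈ S, √(max (P z) (Q z)) ^ 2 ≤ ∑ z ∈ S, (P z + Q z) :=
          Finset.sum_le_sum fun z _ => by
            rw [Real.sq_sqrt ((hP z).trans (le_max_left _ _))]
            exact max_le_add_of_nonneg (hP z) (hQ z)
      _ ≤ 2 := by rw [Finset.sum_add_distrib]; linarith
  rw [h2, mul_comm]
  exact mul_le_mul_of_nonneg_right h3 (Finset.sum_nonneg fun z _ => le_min (hP z) (hQ z))

/-- Two product (sub-)distributions overlap as soon as the sum of the squared Hellinger distances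
of their factors is small. The factors may lack mass `ε`, so that sums over finite sets of words
suffice. -/
theorem one_sub_le_two_mul_sum_min {ι β : Type*} [Fintype ι] [DecidableEq ι] (S : ι → Finset β)
    (p q : ι → β → ℝ) (ε : ℝ)
    (hp : ∀ i z, 0 ≤ p i z) (hq : ∀ i z, 0 ≤ q i z)
    (hp1 : ∀ i, ∑ z ∈ S i, p i z ≤ 1) (hq1 : ∀ i, ∑ z ∈ S i, q i z ≤ 1)
    (hpε : ∀ i, 1 - ε ≤ ∑ z ∈ S i, p i z) (hqε : ∀ i, 1 - ε ≤ ∑ z ∈ S i, q i z) :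
    1 - ∑ i, (2 * ε + ∑ z ∈ S i, (√(p i z) - √(q i z)) ^ 2) ≤
      2 * ∑ z ∈ Fintype.piFinset S, min (∏ i, p i (z i)) (∏ i, q i (z i)) := by
  set a : ι → ℝ := fun i => ∑ z ∈ S i, √(p i z * q i z) with ha
  have key : ∀ i, 2 * a i = ∑ z ∈ S i, p i z + ∑ z ∈ S i, q i z
      - ∑ z ∈ S i, (√(p i z) - √(q i z)) ^ 2 := fun i => by
    rw [ha, Finset.mul_sum, ← Finset.sum_add_distrib, ← Finset.sum_sub_distrib]
    refine Finset.sum_congr rfl fun z _ => ?_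
    rw [Real.sqrt_mul (hp i z), sub_sq, Real.sq_sqrt (hp i z), Real.sq_sqrt (hq i z)]
    ring
  have hh : ∀ i, 0 ≤ ∑ z ∈ S i, (√(p i z) - √(q i z)) ^ 2 := fun i =>
    Finset.sum_nonneg fun z _ => sq_nonneg _
  have ha0 : ∀ i, 0 ≤ a i := fun i => Finset.sum_nonneg fun z _ => Real.sqrt_nonneg _
  have ha1 : ∀ i, a i ≤ 1 := fun i => by linarith [key i, hp1 i, hq1 i, hh i]
  have hprod : ∀ f : ι → β → ℝ, ∑ z ∈ Fintype.piFinset S, ∏ i, f i (z i) = ∏ i, ∑ z ∈ S i, f i z :=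
    fun f => (Finset.prod_univ_sum S f).symm
  have hbc : ∏ i, a i = ∑ z ∈ Fintype.piFinset S, √((∏ i, p i (z i)) * ∏ i, q i (z i)) := by
    rw [ha, ← hprod]
    refine Finset.sum_congr rfl fun z _ => ?_
    rw [← Finset.prod_mul_distrib, Real.sqrt_prod _ fun i _ => mul_nonneg (hp _ _) (hq _ _)]
  have h1 := sq_sum_sqrt_mul_le (Fintype.piFinset S) (fun z => ∏ i, p i (z i))
    (fun z => ∏ i, q i (z i)) (fun z => Finset.prod_nonneg fun i _ => hp _ _)
    (fun z => Finset.prod_nonneg fun i _ => hq _ _)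
    (by rw [hprod]; exact Finset.prod_le_one (fun i _ => Finset.sum_nonneg fun z _ => hp _ _)
          fun i _ => hp1 i)
    (by rw [hprod]; exact Finset.prod_le_one (fun i _ => Finset.sum_nonneg fun z _ => hq _ _)
          fun i _ => hq1 i)
  rw [← hbc] at h1
  refine le_trans ?_ h1
  have h2 := one_sub_sum_le_prod_one_sub Finset.univ (fun i => 1 - a i)
    (fun i _ => by linarith [ha1 i]) (fun i _ => by linarith [ha0 i])
  simp only [sub_sub_cancel] at h2
  have h3 : ∑ i, 2 * (1 - a i) ≤ ∑ i, (2 * ε + ∑ z ∈ S i, (√(p i z) - √(q i z)) ^ 2) :=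
    Finset.sum_le_sum fun i _ => by linarith [key i, hpε i, hqε i]
  rw [← Finset.mul_sum] at h3
  nlinarith [sq_nonneg (∏ i, a i - 1)]

/-- The part of the squared Hellinger distance where the first argument is the larger. -/
noncomputable def hellingerPos (p q : ℝ) : ℝ := max (√p - √q) 0 ^ 2

theorem hellingerPos_add_swap (p q : ℝ) :
    hellingerPos p q + hellingerPos q p = (√p - √q) ^ 2 := by
  unfold hellingerPos
  rcases le_total (√p) (√q) with h | h
  · rw [max_eq_right (by linarith), max_eq_left (by linarith)]; ring
  · rw [max_eq_left (by linarith), max_eq_right (by linarith)]; ring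

/-- Both sides vanish if `p = 0`. -/
theorem hellingerPos_le (p q : ℝ) (hp : 0 ≤ p) (hq : 0 ≤ q) :
    hellingerPos p q ≤ p * (max (p - q) 0 / p) ^ 2 := by
  unfold hellingerPos
  rcases le_total p q with h | h
  · rw [max_eq_right (by linarith [Real.sqrt_le_sqrt h])]
    simp only [ne_eq, OfNat.ofNat_ne_zero, not_false_eq_true, zero_pow]
    positivity
  rcases hp.eq_or_lt with h0 | h0
  · have : q = 0 := le_antisymm (h0 ▸ h) hq
    simp [← h0, this]
  have h1 := Real.sqrt_le_sqrt h
  rw [max_eq_left (by linarith), max_eq_left (by linarith), div_pow, mul_div_assoc',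
    le_div_iff₀ (by positivity)]
  obtain ⟨x, hx, rfl⟩ : ∃ x, 0 < x ∧ x ^ 2 = p := ⟨√p, by positivity, Real.sq_sqrt hp⟩
  obtain ⟨y, hy, rfl⟩ : ∃ y, 0 ≤ y ∧ y ^ 2 = q := ⟨√q, by positivity, Real.sq_sqrt hq⟩
  rw [Real.sqrt_sq hx.le, Real.sqrt_sq hy]
  have : (x - y) ^ 2 * (x ^ 2) ≤ (x ^ 2 - y ^ 2) ^ 2 := by
    have : (x ^ 2 - y ^ 2) ^ 2 = (x - y) ^ 2 * (x + y) ^ 2 := by ring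
    rw [this]
    gcongr
    linarith
  nlinarith [mul_le_mul_of_nonneg_left this (sq_nonneg x)]

section OneMachine

variable {Ω K : Type*} [MeasurableSpace Ω] {P : Measure Ω} [IsProbabilityMeasure P]

/-- A test function `τ` of small mass correlates little with variables whose joint upper tail is
Gaussian: the positive parts of the conditional means `v k = (∫ τ Y_k)⁺ / ∫ τ` have sum of squares
of order `log (1 / ∫ τ)`. The Legendre parameter `a` replaces the logarithm. -/
theorem sum_sq_condMean_le (I : Finset K) (Y : K → Ω → ℝ) (hY : ∀ k, Measurable (Y k))
    (hYi : ∀ k, Integrable (Y k) P) (hY1 : ∀ k x, Y k x ≤ 1) {b : ℝ} (hb : 0 < b)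
    (hmgf : ∀ l : K → ℝ, (∀ k, 0 ≤ l k) →
      ∫ x, Real.exp (∑ k ∈ I, l k * Y k x) ∂P ≤ Real.exp (b * ∑ k ∈ I, l k ^ 2))
    (τ : Ω → ℝ) (hτ : Measurable τ) (h0 : ∀ x, 0 ≤ τ x) (h1 : ∀ x, τ x ≤ 1) (a : ℝ) :
    ∑ k ∈ I, (∫ x, τ x ∂P) * (max (∫ x, τ x * Y k x ∂P) 0 / ∫ x, τ x ∂P) ^ 2 ≤
      4 * b * ((∫ x, τ x ∂P) * a + Real.exp (-a)) := by
  set p := ∫ x, τ x ∂P with hp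
  have hp0 : 0 ≤ p := integral_nonneg h0
  rcases hp0.eq_or_lt with hpz | hpos
  · rw [← hpz]; simp only [zero_mul, Finset.sum_const_zero, zero_add]; positivity
  -- the weights `l k = v k / (2 b)` optimize the resulting quadratic bound
  set v : K → ℝ := fun k => max (∫ x, τ x * Y k x ∂P) 0 / p with hv
  have hv0 : ∀ k, 0 ≤ v k := fun k => div_nonneg (le_max_right _ _) hp0
  set V := ∑ k ∈ I, v k ^ 2 with hV
  set A := a + V / (4 * b) with hA
  have hb0 : b ≠ 0 := hb.ne'
  have hτi : Integrable τ P := Integrable.of_bound hτ.aestronglyMeasurable 1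
    (Filter.Eventually.of_forall fun x => by rw [Real.norm_of_nonneg (h0 x)]; exact h1 x)
  have hτY : ∀ k, Integrable (fun x => τ x * Y k x) P := fun k =>
    (hYi k).bdd_mul hτ.aestronglyMeasurable (c := 1)
      (Filter.Eventually.of_forall fun x => by rw [Real.norm_of_nonneg (h0 x)]; exact h1 x)
  set s : Ω → ℝ := fun x => ∑ k ∈ I, v k / (2 * b) * Y k x with hs
  have hsm : Measurable s := by
    rw [hs]; exact Finset.measurable_sum _ fun k _ => (hY k).const_mul _
  have hsi : Integrable (fun x => Real.exp (s x)) P := by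
    refine Integrable.of_bound (hsm.exp.aestronglyMeasurable)
      (Real.exp (∑ k ∈ I, v k / (2 * b))) (Filter.Eventually.of_forall fun x => ?_)
    rw [Real.norm_of_nonneg (Real.exp_pos _).le]
    refine Real.exp_le_exp.2 (Finset.sum_le_sum fun k _ => ?_)
    have := hv0 k
    exact mul_le_of_le_one_right (by positivity) (hY1 k x)
  have hleft : ∫ x, τ x * s x ∂P = p * V / (2 * b) := by
    have : ∀ x, τ x * s x = ∑ k ∈ I, v k / (2 * b) * (τ x * Y k x) := fun x => by
      rw [hs, Finset.mul_sum]; exact Finset.sum_congr rfl fun k _ => by ring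
    simp_rw [this]
    rw [integral_finsetSum _ fun k _ => (hτY k).const_mul _, hV, Finset.mul_sum, Finset.sum_div]
    refine Finset.sum_congr rfl fun k _ => ?_
    rw [integral_const_mul]
    -- if the correlation is negative then `v k = 0`
    have : v k * ∫ x, τ x * Y k x ∂P = p * v k ^ 2 := by
      simp only [hv]
      rcases le_total (∫ x, τ x * Y k x ∂P) 0 with h | h
      · rw [max_eq_right h]; simp
      · rw [max_eq_left h]; field_simp
    rw [div_mul_eq_mul_div, this]
  have hτsi : Integrable (fun x => τ x * s x) P := by
    have : (fun x => τ x * s x) = fun x => ∑ k ∈ I, v k / (2 * b) * (τ x * Y k x) := by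
      ext x
      rw [hs, Finset.mul_sum]; exact Finset.sum_congr rfl fun k _ => by ring
    rw [this]
    exact integrable_finsetSum _ fun k _ => (hτY k).const_mul _
  -- the entropy inequality, from `s - A + 1 ≤ exp (s - A)`
  have hle : ∫ x, τ x * s x ∂P ≤ ∫ x, (τ x * A + Real.exp (-A) * Real.exp (s x)) ∂P := by
    refine integral_mono hτsi ((hτi.mul_const _).add (hsi.const_mul _)) fun x => ?_
    have e1 := Real.add_one_le_exp (s x - A)
    have e2 : Real.exp (-A) * Real.exp (s x) = Real.exp (s x - A) := by
      rw [← Real.exp_add]; ring_nf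
    simp only [e2]
    have e3 := h0 x
    have e4 := h1 x
    have e5 := Real.exp_pos (s x - A)
    nlinarith [mul_le_mul_of_nonneg_left e1 e3, mul_le_mul_of_nonneg_right e4 e5.le]
  have hm := hmgf (fun k => v k / (2 * b)) fun k => by have := hv0 k; positivity
  have hm' : b * ∑ k ∈ I, (v k / (2 * b)) ^ 2 = V / (4 * b) := by
    simp_rw [div_pow]
    rw [← Finset.sum_div, ← hV]; field_simp; ring
  rw [hm'] at hm
  rw [hleft, integral_add (hτi.mul_const _) (hsi.const_mul _), integral_mul_const,
    integral_const_mul, ← hp] at hle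
  have hfin : Real.exp (-A) * ∫ x, Real.exp (s x) ∂P ≤ Real.exp (-a) := by
    calc Real.exp (-A) * ∫ x, Real.exp (s x) ∂P
        ≤ Real.exp (-A) * Real.exp (V / (4 * b)) := by gcongr
      _ = Real.exp (-a) := by rw [← Real.exp_add, hA]; ring_nf
  have : p * V / (4 * b) ≤ p * a + Real.exp (-a) := by
    have e : p * V / (2 * b) = p * V / (4 * b) + p * (V / (4 * b)) := by field_simp; ring
    have e' : p * A = p * a + p * (V / (4 * b)) := by rw [hA]; ring
    linarith
  rw [div_le_iff₀ (by positivity)] at this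
  rw [← Finset.mul_sum]
  linarith

/-- The crude bound for the same conditional means, additive in `τ`: Jensen's inequality, and
`(y⁺)² ≤ ρ (s + (24 / s) exp (y / √ρ))`. -/
theorem condMean_sq_le (Y : Ω → ℝ) (hY : Measurable Y) (hYi : Integrable Y P)
    (hY1 : ∀ x, Y x ≤ 1) {ρ s : ℝ} (hρ : 0 < ρ) (hs : 0 < s)
    (τ : Ω → ℝ) (hτ : Measurable τ) (h0 : ∀ x, 0 ≤ τ x) (h1 : ∀ x, τ x ≤ 1) :
    (∫ x, τ x ∂P) * (max (∫ x, τ x * Y x ∂P) 0 / ∫ x, τ x ∂P) ^ 2 ≤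
      ρ * (s * ∫ x, τ x ∂P + 24 / s * ∫ x, τ x * Real.exp ((√ρ)⁻¹ * Y x) ∂P) := by
  set p := ∫ x, τ x ∂P with hp
  have hp0 : 0 ≤ p := integral_nonneg h0
  have hτb : ∀ᵐ x ∂P, ‖τ x‖ ≤ 1 :=
    Filter.Eventually.of_forall fun x => by rw [Real.norm_of_nonneg (h0 x)]; exact h1 x
  have hτi : Integrable τ P := Integrable.of_bound hτ.aestronglyMeasurable 1 hτb
  have hr : 0 < √ρ := Real.sqrt_pos.2 hρ
  have hτE : Integrable (fun x => τ x * Real.exp ((√ρ)⁻¹ * Y x)) P := by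
    refine Integrable.bdd_mul (c := 1) ?_ hτ.aestronglyMeasurable hτb
    refine Integrable.of_bound ((hY.const_mul _).exp.aestronglyMeasurable)
      (Real.exp ((√ρ)⁻¹)) (Filter.Eventually.of_forall fun x => ?_)
    rw [Real.norm_of_nonneg (Real.exp_pos _).le]
    exact Real.exp_le_exp.2 (mul_le_of_le_one_right (by positivity) (hY1 x))
  have hτY : Integrable (fun x => τ x * Y x) P :=
    hYi.bdd_mul hτ.aestronglyMeasurable hτb
  rcases hp0.eq_or_lt with hpz | hpos
  · rw [← hpz]
    have : 0 ≤ ∫ x, τ x * Real.exp ((√ρ)⁻¹ * Y x) ∂P :=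
      integral_nonneg fun x => mul_nonneg (h0 x) (Real.exp_pos _).le
    simp only [zero_mul, mul_zero, zero_add]; positivity
  set v := max (∫ x, τ x * Y x ∂P) 0 / p with hv
  have hv0 : 0 ≤ v := div_nonneg (le_max_right _ _) hp0
  have e1 : v * ∫ x, τ x * Y x ∂P = p * v ^ 2 := by
    simp only [hv]
    rcases le_total (∫ x, τ x * Y x ∂P) 0 with h | h
    · rw [max_eq_right h]; simp
    · rw [max_eq_left h]; field_simp
  have pt : ∀ x, v * Y x ≤ v ^ 2 / 2 + ρ / 2 * (s + 24 / s * Real.exp ((√ρ)⁻¹ * Y x)) := by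
    intro x
    have hE := Real.exp_pos ((√ρ)⁻¹ * Y x)
    rcases le_total (Y x) 0 with hy | hy
    · have : v * Y x ≤ 0 := mul_nonpos_of_nonneg_of_nonpos hv0 hy
      have : 0 ≤ v ^ 2 / 2 + ρ / 2 * (s + 24 / s * Real.exp ((√ρ)⁻¹ * Y x)) := by positivity
      linarith
    · set t := (√ρ)⁻¹ * Y x with ht
      have ht0 : 0 ≤ t := by positivity
      have hYt : Y x ^ 2 = ρ * t ^ 2 := by
        rw [ht, mul_pow, inv_pow, Real.sq_sqrt hρ.le]; field_simp
      have h4 : t ^ 4 ≤ 24 * Real.exp t := by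
        have := Real.pow_div_factorial_le_exp t ht0 4
        simp only [Nat.factorial] at this
        norm_num at this
        linarith
      have h5 : t ^ 2 ≤ s + 24 / s * Real.exp t := by
        have : t ^ 2 * s ≤ s ^ 2 + 24 * Real.exp t := by nlinarith [sq_nonneg (t ^ 2 - s)]
        have e : s + 24 / s * Real.exp t = (s ^ 2 + 24 * Real.exp t) / s := by field_simp
        rw [e, le_div_iff₀ hs]; exact this
      nlinarith [sq_nonneg (v - Y x), mul_le_mul_of_nonneg_left h5 hρ.le]
  have hle : ∫ x, v * (τ x * Y x) ∂P ≤ ∫ x, ((v ^ 2 / 2 + ρ / 2 * s) * τ x +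
      (ρ / 2 * (24 / s)) * (τ x * Real.exp ((√ρ)⁻¹ * Y x))) ∂P := by
    refine integral_mono (hτY.const_mul _) ((hτi.const_mul _).add (hτE.const_mul _)) fun x => ?_
    have := mul_le_mul_of_nonneg_left (pt x) (h0 x)
    simp only
    linarith
  rw [integral_const_mul, e1, integral_add (hτi.const_mul _) (hτE.const_mul _),
    integral_const_mul, integral_const_mul, ← hp] at hle
  linarith

end OneMachine

/-! ### Transcript of one machine -/

section OneMachine

variable {Ω K : Type*} [MeasurableSpace Ω] {P : Measure Ω}

theorem bind_real_apply {β : Type*} [MeasurableSpace β] (T : Kernel Ω β) [IsMarkovKernel T]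
    {s : Set β} (hs : MeasurableSet s) :
    (P.bind T).real s = ∫ x, (T x).real s ∂P := by
  rw [measureReal_def, Measure.bind_apply hs T.measurable.aemeasurable]
  exact (integral_toReal (T.measurable_coe hs).aemeasurable
    (Filter.Eventually.of_forall fun x => measure_lt_top _ _)).symm

theorem bind_withDensity_real_apply {β : Type*} [MeasurableSpace β] (T : Kernel Ω β)
    [IsMarkovKernel T] {s : Set β} (hs : MeasurableSet s) {f : Ω → ℝ} (hf : Measurable f)
    (hf0 : ∀ x, 0 ≤ f x) :
    ((P.withDensity fun x => ENNReal.ofReal (f x)).bind T).real s =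
      ∫ x, (T x).real s * f x ∂P := by
  rw [bind_real_apply T hs, integral_withDensity_eq_integral_toReal_smul hf.ennreal_ofReal
    (Filter.Eventually.of_forall fun x => ENNReal.ofReal_lt_top)]
  refine integral_congr_ae (Filter.Eventually.of_forall fun x => ?_)
  simp [ENNReal.toReal_ofReal (hf0 x), mul_comm]

variable [IsProbabilityMeasure P]

/-- Bounds the Hellinger information about all the coordinates `k` in the transcript of one
machine. Words of length at most `t` contribute through the codelength, as in
`sum_sq_condMean_le` and by Kraft's inequality; the longer words contribute proportionally to
their probability, by `condMean_sq_le`. -/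
theorem sum_hellingerPos_le (T : Kernel Ω (List Bool)) [IsMarkovKernel T] (I : Finset K)
    (f : K → Ω → ℝ) (hf : ∀ k, Measurable (f k)) (hf0 : ∀ k x, 0 ≤ f k x)
    [∀ k, IsProbabilityMeasure (P.withDensity fun x => ENNReal.ofReal (f k x))]
    {κ ρ s t : ℝ} (hκ : 0 < κ) (hρ : 0 < ρ) (hs : 0 < s) (ht : 0 ≤ t)
    (hmgf : ∀ l : K → ℝ, (∀ k, 0 ≤ l k) →
      ∫ x, Real.exp (∑ k ∈ I, l k * (1 - f k x)) ∂P ≤ Real.exp (κ * ρ * ∑ k ∈ I, l k ^ 2))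
    (S : Finset (List Bool)) (hS : InformationTheory.UniquelyDecodable (S : Set (List Bool))) :
    ∑ k ∈ I, ∑ z ∈ S, hellingerPos ((P.bind T).real {z})
        (((P.withDensity fun x => ENNReal.ofReal (f k x)).bind T).real {z}) ≤
      4 * (κ * ρ) * (t + 1) +
        I.card * (ρ * (s * (P.bind T).real {z | t < z.length} + 24 / s * Real.exp κ)) := by
  classical
  set Y : K → Ω → ℝ := fun k x => 1 - f k x with hY
  have hYm : ∀ k, Measurable (Y k) := fun k => (hf k).const_sub 1
  have hfi : ∀ k, Integrable (f k) P := fun k => by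
    refine ⟨(hf k).aestronglyMeasurable, ?_⟩
    rw [hasFiniteIntegral_iff_ofReal (Filter.Eventually.of_forall (hf0 k))]
    have := measure_univ (μ := P.withDensity fun x => ENNReal.ofReal (f k x))
    rw [withDensity_apply _ MeasurableSet.univ, Measure.restrict_univ] at this
    rw [this]; exact ENNReal.one_lt_top
  have hYi : ∀ k, Integrable (Y k) P := fun k => (integrable_const _).sub (hfi k)
  have hY1 : ∀ k x, Y k x ≤ 1 := fun k x => by simp only [hY]; linarith [hf0 k x]
  set τ : List Bool → Ω → ℝ := fun z x => (T x).real {z} with hτ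
  have hms : ∀ A : Set (List Bool), MeasurableSet A := fun A => trivial
  have hτm : ∀ z, Measurable (τ z) := fun z => (T.measurable_coe (hms _)).ennreal_toReal
  have hτ0 : ∀ z x, 0 ≤ τ z x := fun z x => measureReal_nonneg
  have hτ1 : ∀ z x, τ z x ≤ 1 := fun z x => measureReal_le_one
  have hτb : ∀ z, ∀ᵐ x ∂P, ‖τ z x‖ ≤ 1 := fun z =>
    Filter.Eventually.of_forall fun x => by rw [Real.norm_of_nonneg (hτ0 z x)]; exact hτ1 z x
  have hτi : ∀ z, Integrable (τ z) P := fun z =>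
    Integrable.of_bound (hτm z).aestronglyMeasurable 1 (hτb z)
  set g : K → List Bool → ℝ := fun k z =>
    (∫ x, τ z x ∂P) * (max (∫ x, τ z x * Y k x ∂P) 0 / ∫ x, τ z x ∂P) ^ 2 with hg
  have hle : ∀ k z, hellingerPos ((P.bind T).real {z})
      (((P.withDensity fun x => ENNReal.ofReal (f k x)).bind T).real {z}) ≤ g k z := fun k z => by
    refine (hellingerPos_le _ _ measureReal_nonneg measureReal_nonneg).trans_eq ?_
    rw [bind_real_apply T (hms _), bind_withDensity_real_apply T (hms _) (hf k) (hf0 k)]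
    have : ∫ x, τ z x * Y k x ∂P = ∫ x, τ z x ∂P - ∫ x, τ z x * f k x ∂P := by
      rw [← integral_sub (hτi z)
        ((hfi k).bdd_mul (hτm z).aestronglyMeasurable (hτb z))]
      refine integral_congr_ae (Filter.Eventually.of_forall fun x => ?_)
      simp only [hY]; ring
    simp only [hg]
    rw [this]
  have hb : 0 < κ * ρ := mul_pos hκ hρ
  set Ssh := S.filter fun z => (z.length : ℝ) ≤ t with hSsh
  set Slg := S.filter fun z => ¬ (z.length : ℝ) ≤ t with hSlg
  have hmass : ∀ S' : Finset (List Bool),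
      ∑ z ∈ S', ∫ x, τ z x ∂P = (P.bind T).real (S' : Set (List Bool)) := fun S' => by
    rw [← integral_finsetSum _ fun z _ => hτi z, bind_real_apply T (hms _)]
    refine integral_congr_ae (Filter.Eventually.of_forall fun x => ?_)
    simp only [hτ]
    rw [sum_measureReal_singleton]
  have hlog : 0 ≤ Real.log 2 ∧ Real.log 2 ≤ 1 :=
    ⟨Real.log_nonneg (by norm_num), by linarith [Real.log_two_lt_d9]⟩
  have hshort : ∑ z ∈ Ssh, ∑ k ∈ I, g k z ≤ 4 * (κ * ρ) * (t + 1) := by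
    have h1 : ∀ z ∈ Ssh, ∑ k ∈ I, g k z ≤
        4 * (κ * ρ) * ((∫ x, τ z x ∂P) * t + (1 / Fintype.card Bool : ℝ) ^ z.length) := by
      intro z hz
      refine (sum_sq_condMean_le I Y hYm hYi hY1 hb hmgf (τ z) (hτm z) (hτ0 z) (hτ1 z)
        (z.length * Real.log 2)).trans ?_
      have hzt : (z.length : ℝ) ≤ t := (Finset.mem_filter.1 hz).2
      have e1 : Real.exp (-(z.length * Real.log 2)) = (1 / Fintype.card Bool : ℝ) ^ z.length := by
        rw [← mul_neg, Real.exp_nat_mul, Real.exp_neg, Real.exp_log (by norm_num)]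
        norm_num
      rw [e1]
      have e2 : 0 ≤ ∫ x, τ z x ∂P := integral_nonneg (hτ0 z)
      have e3 : (z.length : ℝ) * Real.log 2 ≤ t :=
        (mul_le_of_le_one_right (Nat.cast_nonneg _) hlog.2).trans hzt
      gcongr
    refine (Finset.sum_le_sum h1).trans ?_
    rw [← Finset.mul_sum, Finset.sum_add_distrib, ← Finset.sum_mul, hmass]
    have hk : ∑ z ∈ Ssh, (1 / Fintype.card Bool : ℝ) ^ z.length ≤ 1 := by
      refine InformationTheory.kraft_mcmillan_inequality fun L₁ L₂ h1 h2 => hS L₁ L₂ ?_ ?_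
      · exact fun w hw => Finset.filter_subset _ _ (h1 w hw)
      · exact fun w hw => Finset.filter_subset _ _ (h2 w hw)
    have : (P.bind T).real (Ssh : Set (List Bool)) * t ≤ t :=
      mul_le_of_le_one_left ht measureReal_le_one
    gcongr
  have hlong : ∀ k ∈ I, ∑ z ∈ Slg, g k z ≤
      ρ * (s * (P.bind T).real {z | t < z.length} + 24 / s * Real.exp κ) := by
    intro k hk
    have hE : Integrable (fun x => Real.exp ((√ρ)⁻¹ * Y k x)) P := by
      refine Integrable.of_bound (((hYm k).const_mul _).exp.aestronglyMeasurable)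
        (Real.exp ((√ρ)⁻¹)) (Filter.Eventually.of_forall fun x => ?_)
      rw [Real.norm_of_nonneg (Real.exp_pos _).le]
      exact Real.exp_le_exp.2 (mul_le_of_le_one_right (by positivity) (hY1 k x))
    refine (Finset.sum_le_sum fun z _ => condMean_sq_le (Y k) (hYm k) (hYi k) (hY1 k) hρ hs (τ z)
      (hτm z) (hτ0 z) (hτ1 z)).trans ?_
    rw [← Finset.mul_sum, Finset.sum_add_distrib, ← Finset.mul_sum, ← Finset.mul_sum, hmass]
    have e1 : (P.bind T).real (Slg : Set (List Bool)) ≤ (P.bind T).real {z | t < z.length} := by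
      refine measureReal_mono fun z hz => ?_
      simpa using (Finset.mem_filter.1 hz).2
    have e2 : ∑ z ∈ Slg, ∫ x, τ z x * Real.exp ((√ρ)⁻¹ * Y k x) ∂P ≤ Real.exp κ := by
      rw [← integral_finsetSum _ fun z _ => hE.bdd_mul (hτm z).aestronglyMeasurable (hτb z)]
      calc ∫ x, ∑ z ∈ Slg, τ z x * Real.exp ((√ρ)⁻¹ * Y k x) ∂P
          ≤ ∫ x, Real.exp ((√ρ)⁻¹ * Y k x) ∂P := by
            refine integral_mono (integrable_finsetSum _ fun z _ =>
              hE.bdd_mul (hτm z).aestronglyMeasurable (hτb z)) hE fun x => ?_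
            simp only [← Finset.sum_mul, hτ]
            rw [sum_measureReal_singleton]
            exact mul_le_of_le_one_left (Real.exp_pos _).le measureReal_le_one
        _ ≤ Real.exp κ := by
            have := hmgf (Pi.single k (√ρ)⁻¹) fun j => by
              by_cases h : j = k
              · subst h; simp
              · simp [h]
            have e3 : ∀ x, ∑ j ∈ I, (Pi.single k (√ρ)⁻¹ : K → ℝ) j * (1 - f j x) =
                (√ρ)⁻¹ * Y k x := fun x => by
              rw [Finset.sum_eq_single k (fun j _ hj => by simp [hj]) fun h => absurd hk h]
              simp [hY]
            have e4 : κ * ρ * ∑ j ∈ I, (Pi.single k (√ρ)⁻¹ : K → ℝ) j ^ 2 = κ := by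
              rw [Finset.sum_eq_single k (fun j _ hj => by simp [hj]) fun h => absurd hk h]
              simp only [Pi.single_eq_same, inv_pow, Real.sq_sqrt hρ.le]
              field_simp
            simp_rw [e3] at this
            rwa [e4] at this
    gcongr
  calc _ ≤ ∑ k ∈ I, ∑ z ∈ S, g k z :=
        Finset.sum_le_sum fun k _ => Finset.sum_le_sum fun z _ => hle k z
    _ = ∑ k ∈ I, (∑ z ∈ Ssh, g k z + ∑ z ∈ Slg, g k z) :=
        Finset.sum_congr rfl fun k _ => (Finset.sum_filter_add_sum_filter_not _ _ _).symm
    _ = ∑ z ∈ Ssh, ∑ k ∈ I, g k z + ∑ k ∈ I, ∑ z ∈ Slg, g k z := by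
        rw [Finset.sum_add_distrib, Finset.sum_comm]
    _ ≤ _ := by
        refine add_le_add hshort ((Finset.sum_le_sum hlong).trans_eq ?_)
        rw [Finset.sum_const, nsmul_eq_mul]

end OneMachine

/-! ### Gaussian likelihood ratios -/

section Gaussian

variable {σ : ℝ}

/-- The likelihood ratio, at the observation `x`, of `N(μ + d, σ²)` against `N(μ, σ²)`. -/
noncomputable def gaussianLR (σ μ d x : ℝ) : ℝ := Real.exp ((d * (x - μ) - d ^ 2 / 2) / σ ^ 2)

theorem gaussianLR_pos (σ μ d x : ℝ) : 0 < gaussianLR σ μ d x := Real.exp_pos _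

theorem measurable_gaussianLR (σ μ d : ℝ) : Measurable (gaussianLR σ μ d) := by
  unfold gaussianLR; fun_prop

theorem gaussianReal_add_eq_withDensity (hσ : 0 < σ) (μ d : ℝ) :
    gaussianReal (μ + d) (Real.toNNReal (σ ^ 2)) =
      (gaussianReal μ (Real.toNNReal (σ ^ 2))).withDensity
        fun x => ENNReal.ofReal (gaussianLR σ μ d x) := by
  have hv : Real.toNNReal (σ ^ 2) ≠ 0 := by simp [hσ.ne']
  rw [gaussianReal_of_var_ne_zero _ hv, gaussianReal_of_var_ne_zero _ hv,
    ← withDensity_mul _ (measurable_gaussianPDF _ _) (measurable_gaussianLR _ _ _).ennreal_ofReal]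
  congr 1
  ext x
  simp only [Pi.mul_apply, gaussianPDF]
  rw [← ENNReal.ofReal_mul (gaussianPDFReal_nonneg _ _ _)]
  congr 1
  simp only [gaussianPDFReal, gaussianLR, Real.coe_toNNReal _ (sq_nonneg σ)]
  rw [mul_assoc _ (Real.exp _) (Real.exp _), ← Real.exp_add]
  congr 2
  field_simp
  ring

theorem lintegral_gaussianLR (hσ : 0 < σ) (μ d : ℝ) :
    ∫⁻ x, ENNReal.ofReal (gaussianLR σ μ d x) ∂gaussianReal μ (Real.toNNReal (σ ^ 2)) = 1 := by
  have := measure_univ (μ := gaussianReal (μ + d) (Real.toNNReal (σ ^ 2)))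
  rwa [gaussianReal_add_eq_withDensity hσ, withDensity_apply _ MeasurableSet.univ,
    Measure.restrict_univ] at this

theorem integrable_gaussianLR (hσ : 0 < σ) (μ d : ℝ) :
    Integrable (gaussianLR σ μ d) (gaussianReal μ (Real.toNNReal (σ ^ 2))) := by
  refine ⟨(measurable_gaussianLR _ _ _).aestronglyMeasurable, ?_⟩
  rw [hasFiniteIntegral_iff_ofReal
    (Filter.Eventually.of_forall fun x => (gaussianLR_pos _ _ _ _).le), lintegral_gaussianLR hσ]
  exact ENNReal.one_lt_top

theorem integral_gaussianLR (hσ : 0 < σ) (μ d : ℝ) :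
    ∫ x, gaussianLR σ μ d x ∂gaussianReal μ (Real.toNNReal (σ ^ 2)) = 1 := by
  rw [integral_eq_lintegral_of_nonneg_ae
    (Filter.Eventually.of_forall fun x => (gaussianLR_pos _ _ _ _).le)
    (measurable_gaussianLR _ _ _).aestronglyMeasurable, lintegral_gaussianLR hσ]
  simp

/-- Powers of a Gaussian likelihood ratio are multiples of likelihood ratios. -/
theorem gaussianLR_rpow (σ μ d t x : ℝ) :
    Real.exp (t * ((d * (x - μ) - d ^ 2 / 2) / σ ^ 2)) =
      Real.exp ((t ^ 2 - t) * d ^ 2 / (2 * σ ^ 2)) * gaussianLR σ μ (t * d) x := by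
  rw [gaussianLR, ← Real.exp_add]
  congr 1
  by_cases h : σ = 0
  · simp [h]
  · field_simp; ring

/-- The variable `1 - dN(μ + d, σ²) / dN(μ, σ²)` has a Gaussian upper tail, of variance proxy
proportional to the squared signal to noise ratio `(d / σ)²`. (Its lower tail is heavier than
exponential, so `l ≥ 0` is essential.) -/
theorem integral_exp_one_sub_gaussianLR_le (hσ : 0 < σ) (μ : ℝ) {d ρ β l : ℝ}
    (hd : d ^ 2 = 4 * ρ * σ ^ 2) (hρ : 0 ≤ ρ) (hρβ : ρ ≤ β) (hl : 0 ≤ l) :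
    ∫ x, Real.exp (l * (1 - gaussianLR σ μ d x)) ∂gaussianReal μ (Real.toNNReal (σ ^ 2)) ≤
      Real.exp (4 * Real.exp (4 * β) * ρ * l ^ 2) := by
  set G := gaussianReal μ (Real.toNNReal (σ ^ 2)) with hG
  have hσ2 : σ ^ 2 ≠ 0 := by positivity
  have hint : Integrable (fun x => Real.exp (l * (1 - gaussianLR σ μ d x))) G := by
    refine Integrable.of_bound
      ((((measurable_gaussianLR σ μ d).const_sub 1).const_mul l).exp.aestronglyMeasurable)
      (Real.exp l) (Filter.Eventually.of_forall fun x => ?_)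
    rw [Real.norm_of_nonneg (Real.exp_pos _).le]
    exact Real.exp_le_exp.2 (mul_le_of_le_one_right hl (by linarith [gaussianLR_pos σ μ d x]))
  have hβ : 1 ≤ Real.exp (4 * β) := Real.one_le_exp (by linarith)
  rcases le_total l 1 with h1 | h1
  · -- second order expansion, valid on the whole range `y ≤ 1`
    have hexp : ∀ y : ℝ, y ≤ 1 → Real.exp y ≤ 1 + y + y ^ 2 := by
      intro y hy
      rcases le_total (-1) y with h | h
      · have := (abs_le.1 (Real.abs_exp_sub_one_sub_id_le (abs_le.2 ⟨h, hy⟩))).2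
        linarith
      · have : Real.exp y ≤ 1 := Real.exp_le_one_iff.2 (by linarith)
        nlinarith
    have hsq : ∀ x, gaussianLR σ μ d x ^ 2 = Real.exp (4 * ρ) * gaussianLR σ μ (2 * d) x := by
      intro x
      have := gaussianLR_rpow σ μ d 2 x
      rw [hd] at this
      have e : (2 ^ 2 - 2) * (4 * ρ * σ ^ 2) / (2 * σ ^ 2) = 4 * ρ := by field_simp; ring
      rw [e] at this
      rw [← this, gaussianLR, ← Real.exp_nat_mul, hd]
      norm_num
    have hb : ∀ x, Real.exp (l * (1 - gaussianLR σ μ d x)) ≤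
        (1 + l + l ^ 2) + (-(l + 2 * l ^ 2)) * gaussianLR σ μ d x +
          l ^ 2 * Real.exp (4 * ρ) * gaussianLR σ μ (2 * d) x := by
      intro x
      have h := hexp (l * (1 - gaussianLR σ μ d x)) (by nlinarith [gaussianLR_pos σ μ d x])
      have h2 := hsq x
      refine h.trans_eq ?_
      rw [mul_assoc (l ^ 2), ← h2]; ring
    have hi1 := (integrable_gaussianLR hσ μ d).const_mul (-(l + 2 * l ^ 2))
    have hi2 := (integrable_gaussianLR hσ μ (2 * d)).const_mul (l ^ 2 * Real.exp (4 * ρ))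
    have hi0 : Integrable (fun x => (1 + l + l ^ 2) + (-(l + 2 * l ^ 2)) * gaussianLR σ μ d x) G :=
      (integrable_const _).add hi1
    refine (integral_mono hint (hi0.add hi2) hb).trans ?_
    simp only [Pi.add_apply]
    rw [integral_add hi0 hi2, integral_add (integrable_const _) hi1, integral_const_mul,
      integral_const_mul, integral_gaussianLR hσ, integral_gaussianLR hσ]
    simp only [integral_const, probReal_univ, smul_eq_mul]
    have e1 : Real.exp (4 * ρ) - 1 ≤ 4 * ρ * Real.exp (4 * β) := by
      have := Real.add_one_le_exp (-(4 * ρ))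
      have e : Real.exp (4 * ρ) * Real.exp (-(4 * ρ)) = 1 := by rw [← Real.exp_add]; simp
      have e3 : Real.exp (4 * ρ) ≤ Real.exp (4 * β) := Real.exp_le_exp.2 (by linarith)
      have e4 := Real.exp_pos (4 * ρ)
      nlinarith [mul_le_mul_of_nonneg_left this e4.le, mul_le_mul_of_nonneg_left e3 hρ]
    have e2 := Real.add_one_le_exp (4 * Real.exp (4 * β) * ρ * l ^ 2)
    nlinarith [mul_le_mul_of_nonneg_left e1 (sq_nonneg l)]
  · -- `1 - y ≤ -log y` reduces to a Gaussian moment generating function, whose linear term in `l`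
    -- is dominated by the quadratic one as `l ≥ 1`
    have hb : ∀ x, Real.exp (l * (1 - gaussianLR σ μ d x)) ≤
        Real.exp ((l ^ 2 + l) * (2 * ρ)) * gaussianLR σ μ (-l * d) x := by
      intro x
      have h := Real.add_one_le_exp ((d * (x - μ) - d ^ 2 / 2) / σ ^ 2)
      have h2 := gaussianLR_rpow σ μ d (-l) x
      rw [hd] at h2
      have e : ((-l) ^ 2 - -l) * (4 * ρ * σ ^ 2) / (2 * σ ^ 2) = (l ^ 2 + l) * (2 * ρ) := by
        field_simp; ring
      rw [e] at h2
      rw [← h2, ← hd]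
      refine Real.exp_le_exp.2 ?_
      unfold gaussianLR
      nlinarith
    refine (integral_mono hint ((integrable_gaussianLR hσ μ (-l * d)).const_mul _) hb).trans ?_
    rw [integral_const_mul, integral_gaussianLR hσ, mul_one]
    refine Real.exp_le_exp.2 ?_
    have e1 : l ≤ l ^ 2 := by nlinarith
    have e2 : 0 ≤ ρ * l ^ 2 := by positivity
    nlinarith [mul_le_mul_of_nonneg_right hβ e2, mul_le_mul_of_nonneg_left e1 hρ]

end Gaussian

section Product

instance (σ : ℝ) (θ : Coeff) : IsProbabilityMeasure (observationLaw σ θ) := by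
  unfold observationLaw; infer_instance

theorem lintegral_prod_observationLaw (σ : ℝ) (θ : Coeff) (I : Finset Idx) (f : Idx → ℝ → ℝ≥0∞)
    (hf : ∀ i, Measurable (f i)) :
    ∫⁻ x, ∏ i ∈ I, f i (x i) ∂observationLaw σ θ =
      ∏ i ∈ I, ∫⁻ x, f i x ∂gaussianReal (θ i) (Real.toNNReal (σ ^ 2)) := by
  unfold observationLaw
  refine (lintegral_prod_eq_prod_lintegral_of_indepFun I (fun i (x : Coeff) => f i (x i))
    (iIndepFun_infinitePi hf) fun i => (hf i).comp (measurable_pi_apply i)).trans ?_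
  refine Finset.prod_congr rfl fun i _ => ?_
  rw [← Measure.infinitePi_map_eval (fun i : Idx => gaussianReal (θ i) (Real.toNNReal (σ ^ 2))) i,
    lintegral_map (hf i) (measurable_pi_apply i)]

/-- Changing finitely many coefficients changes the observation law by the product of the
corresponding one-dimensional likelihood ratios. -/
theorem observationLaw_eq_withDensity {σ : ℝ} (hσ : 0 < σ) (θ θ' : Coeff) (I : Finset Idx)
    (h : ∀ i ∉ I, θ' i = θ i) :
    observationLaw σ θ' = (observationLaw σ θ).withDensity
      fun x => ENNReal.ofReal (∏ i ∈ I, gaussianLR σ (θ i) (θ' i - θ i) (x i)) := by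
  classical
  symm
  refine Measure.eq_infinitePi _ fun s t ht => ?_
  have hms : MeasurableSet (Set.pi (s : Set Idx) t) :=
    MeasurableSet.pi s.countable_toSet fun i _ => ht i
  have hLR : ∀ i, Measurable fun x : ℝ =>
      ENNReal.ofReal (gaussianLR σ (θ i) (θ' i - θ i) x) :=
    fun i => (measurable_gaussianLR _ _ _).ennreal_ofReal
  rw [withDensity_apply _ hms, ← lintegral_indicator hms]
  set F : Idx → ℝ → ℝ≥0∞ := fun i x =>
    (if i ∈ s then (t i).indicator 1 x else 1) *
      (if i ∈ I then ENNReal.ofReal (gaussianLR σ (θ i) (θ' i - θ i) x) else 1) with hF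
  have hFm : ∀ i, Measurable (F i) := fun i => by
    refine Measurable.mul ?_ ?_
    · split_ifs
      · exact measurable_one.indicator (ht i)
      · exact measurable_const
    · split_ifs
      · exact hLR i
      · exact measurable_const
  have h1 : ∀ x : Coeff, (Set.pi (s : Set Idx) t).indicator (fun x => ENNReal.ofReal
      (∏ i ∈ I, gaussianLR σ (θ i) (θ' i - θ i) (x i))) x = ∏ i ∈ s ∪ I, F i (x i) := by
    intro x
    simp only [hF]
    rw [Finset.prod_mul_distrib, Finset.prod_ite_mem, Finset.prod_ite_mem,
      Finset.union_inter_cancel_left, Finset.union_inter_cancel_right]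
    by_cases hx : x ∈ Set.pi (s : Set Idx) t
    · rw [Set.indicator_of_mem hx, Finset.prod_eq_one (s := s), one_mul,
        ENNReal.ofReal_prod_of_nonneg fun i _ => (gaussianLR_pos _ _ _ _).le]
      intro i hi
      rw [Set.indicator_of_mem (hx i hi)]; rfl
    · rw [Set.indicator_of_notMem hx]
      obtain ⟨i, hi, hit⟩ : ∃ i ∈ s, x i ∉ t i := by
        by_contra hc; push Not at hc; exact hx fun i hi => hc i hi
      rw [Finset.prod_eq_zero hi (Set.indicator_of_notMem hit _), zero_mul]
  simp_rw [h1]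
  rw [lintegral_prod_observationLaw σ θ _ F hFm]
  have h2 : ∀ i, ∫⁻ x, F i x ∂gaussianReal (θ i) (Real.toNNReal (σ ^ 2)) =
      if i ∈ s then gaussianReal (θ' i) (Real.toNNReal (σ ^ 2)) (t i) else 1 := by
    intro i
    have hG : gaussianReal (θ' i) (Real.toNNReal (σ ^ 2)) =
        (gaussianReal (θ i) (Real.toNNReal (σ ^ 2))).withDensity fun x =>
          if i ∈ I then ENNReal.ofReal (gaussianLR σ (θ i) (θ' i - θ i) x) else 1 := by
      by_cases hi : i ∈ I
      · simp only [hi, if_true]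
        rw [← gaussianReal_add_eq_withDensity hσ]; congr 1; ring
      · simp only [hi, if_false, h i hi]
        exact withDensity_one.symm
    by_cases his : i ∈ s
    · simp only [hF, his, if_true]
      rw [hG, withDensity_apply _ (ht i), ← lintegral_indicator (ht i)]
      refine lintegral_congr fun x => ?_
      by_cases hx : x ∈ t i <;> simp [hx]
    · simp only [hF, his, if_false, one_mul]
      have := measure_univ (μ := gaussianReal (θ' i) (Real.toNNReal (σ ^ 2)))
      rwa [hG, withDensity_apply _ MeasurableSet.univ, Measure.restrict_univ] at this
  simp_rw [h2]
  rw [Finset.prod_ite_mem, Finset.union_inter_cancel_left]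

/-- The tensorized form of `integral_exp_one_sub_gaussianLR_le`. -/
theorem integral_exp_sum_one_sub_gaussianLR_le {σ : ℝ} (hσ : 0 < σ) (θ : Coeff) (I : Finset Idx)
    (d : Idx → ℝ) {ρ β : ℝ} (hd : ∀ i, d i ^ 2 = 4 * ρ * σ ^ 2) (hρ : 0 ≤ ρ) (hρβ : ρ ≤ β)
    (l : Idx → ℝ) (hl : ∀ i, 0 ≤ l i) :
    ∫ x, Real.exp (∑ i ∈ I, l i * (1 - gaussianLR σ (θ i) (d i) (x i))) ∂observationLaw σ θ ≤
      Real.exp (4 * Real.exp (4 * β) * ρ * ∑ i ∈ I, l i ^ 2) := by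
  have hm : ∀ i, Measurable fun x => Real.exp (l i * (1 - gaussianLR σ (θ i) (d i) x)) :=
    fun i => (((measurable_gaussianLR σ (θ i) (d i)).const_sub 1).const_mul (l i)).exp
  have hint : ∀ i, Integrable (fun x => Real.exp (l i * (1 - gaussianLR σ (θ i) (d i) x)))
      (gaussianReal (θ i) (Real.toNNReal (σ ^ 2))) := fun i => by
    refine Integrable.of_bound (hm i).aestronglyMeasurable
      (Real.exp (l i)) (Filter.Eventually.of_forall fun x => ?_)
    rw [Real.norm_of_nonneg (Real.exp_pos _).le]
    exact Real.exp_le_exp.2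
      (mul_le_of_le_one_right (hl i) (by linarith [gaussianLR_pos σ (θ i) (d i) x]))
  have hmx : Measurable fun x : Coeff =>
      Real.exp (∑ i ∈ I, l i * (1 - gaussianLR σ (θ i) (d i) (x i))) := by
    refine (Finset.measurable_sum _ fun i _ => ?_).exp
    exact (((measurable_gaussianLR σ (θ i) (d i)).const_sub 1).const_mul (l i)).comp
      (measurable_pi_apply i)
  rw [integral_eq_lintegral_of_nonneg_ae
    (Filter.Eventually.of_forall fun x => (Real.exp_pos _).le) hmx.aestronglyMeasurable]
  have h1 : ∀ x : Coeff, ENNReal.ofReal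
      (Real.exp (∑ i ∈ I, l i * (1 - gaussianLR σ (θ i) (d i) (x i)))) =
      ∏ i ∈ I, ENNReal.ofReal (Real.exp (l i * (1 - gaussianLR σ (θ i) (d i) (x i)))) := fun x => by
    rw [Real.exp_sum, ENNReal.ofReal_prod_of_nonneg fun i _ => (Real.exp_pos _).le]
  simp_rw [h1]
  rw [lintegral_prod_observationLaw σ θ I
    (fun i x => ENNReal.ofReal (Real.exp (l i * (1 - gaussianLR σ (θ i) (d i) x))))
    fun i => (hm i).ennreal_ofReal]
  refine ENNReal.toReal_le_of_le_ofReal (Real.exp_pos _).le ?_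
  rw [Finset.mul_sum, Real.exp_sum, ENNReal.ofReal_prod_of_nonneg fun i _ => (Real.exp_pos _).le]
  refine Finset.prod_le_prod' fun i _ => ?_
  rw [← ofReal_integral_eq_lintegral_ofReal (hint i)
    (Filter.Eventually.of_forall fun x => (Real.exp_pos _).le)]
  exact ENNReal.ofReal_le_ofReal
    (integral_exp_one_sub_gaussianLR_le hσ (θ i) (hd i) hρ hρβ (hl i))

end Product

/-! ### Cubes of hypotheses and two-point bounds -/

instance measurableSingletonClass_words : MeasurableSingletonClass (List Bool) :=
  ⟨fun _ => trivial⟩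

/-- The coefficient sequence with entries `δ` on `u` and `-δ` on the rest of `I`, and zero outside
`I`; for `u ⊆ I` these are the vertices of a cube. -/
noncomputable def vertex (I : Finset Idx) (δ : ℝ) (u : Finset Idx) : Coeff :=
  fun i => if i ∈ I then (if i ∈ u then δ else -δ) else 0

theorem sum_powerset_symmDiff_singleton {M : Type*} [AddCommMonoid M] (I : Finset Idx) {k : Idx}
    (hk : k ∈ I) (f : Finset Idx → M) :
    ∑ u ∈ I.powerset, f (symmDiff u {k}) = ∑ u ∈ I.powerset, f u := by
  have hmem : ∀ u ∈ I.powerset, symmDiff u {k} ∈ I.powerset := fun u hu => by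
    rw [Finset.mem_powerset] at hu ⊢
    intro i hi
    rcases Finset.mem_symmDiff.1 hi with h | h
    · exact hu h.1
    · rw [Finset.mem_singleton.1 h.1]; exact hk
  exact Finset.sum_nbij' (fun u => symmDiff u {k}) (fun u => symmDiff u {k}) hmem hmem
    (fun u _ => symmDiff_symmDiff_cancel_right _ _) (fun u _ => symmDiff_symmDiff_cancel_right _ _)
    fun u _ => rfl

theorem sum_powerset_sum_symmDiff_singleton {M : Type*} [AddCommMonoid M] (I : Finset Idx)
    (F : Finset Idx → Idx → M) :
    ∑ u ∈ I.powerset, ∑ k ∈ I, F (symmDiff u {k}) k = ∑ u ∈ I.powerset, ∑ k ∈ I, F u k := by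
  rw [Finset.sum_comm, Finset.sum_comm (s := I.powerset)]
  exact Finset.sum_congr rfl fun k hk => sum_powerset_symmDiff_singleton I hk fun u => F u k

theorem ofReal_sum_le {ι : Type*} (s : Finset ι) (f : ι → ℝ) :
    ENNReal.ofReal (∑ i ∈ s, f i) ≤ ∑ i ∈ s, ENNReal.ofReal (f i) :=
  Finset.le_sum_of_subadditive _ ENNReal.ofReal_zero.le (fun _ _ => ENNReal.ofReal_add_le) s f

theorem vertex_symmDiff_of_ne (I : Finset Idx) (δ : ℝ) (u : Finset Idx) {i k : Idx} (h : i ≠ k) :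
    vertex I δ (symmDiff u {k}) i = vertex I δ u i := by
  simp [vertex, Finset.mem_symmDiff, h]

theorem vertex_symmDiff_self (I : Finset Idx) (δ : ℝ) (u : Finset Idx) {k : Idx} :
    vertex I δ (symmDiff u {k}) k = - vertex I δ u k := by
  by_cases hk : k ∈ I <;> by_cases hu : k ∈ u <;> simp [vertex, Finset.mem_symmDiff, hk, hu]

theorem vertex_sq {I : Finset Idx} (δ : ℝ) (u : Finset Idx) {k : Idx} (hk : k ∈ I) :
    vertex I δ u k ^ 2 = δ ^ 2 := by
  by_cases hu : k ∈ u <;> simp [vertex, hk, hu]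

theorem sum_mul_measure_singleton_le {α : Type*} [MeasurableSpace α] [MeasurableSingletonClass α]
    (μ : Measure α) (S : Finset α) (f : α → ℝ≥0∞) :
    ∑ z ∈ S, f z * μ {z} ≤ ∫⁻ z, f z ∂μ := by
  classical
  calc ∑ z ∈ S, f z * μ {z} = ∑ z ∈ S, ∫⁻ y, Set.indicator {z} (fun _ => f z) y ∂μ :=
        Finset.sum_congr rfl fun z _ => by
          rw [lintegral_indicator_const (measurableSet_singleton z)]
    _ = ∫⁻ y, ∑ z ∈ S, Set.indicator {z} (fun _ => f z) y ∂μ :=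
        (lintegral_finsetSum _ fun z _ =>
          measurable_const.indicator (measurableSet_singleton z)).symm
    _ ≤ ∫⁻ z, f z ∂μ := by
        refine lintegral_mono fun y => ?_
        simp only [Set.indicator_apply, Set.mem_singleton_iff]
        rw [Finset.sum_ite_eq]
        split_ifs <;> simp

namespace DistributedEstimator

variable {m : ℕ}

/-- The law of the word sent by machine `i`. -/
noncomputable def wordLaw (T : DistributedEstimator m) (σ : ℝ) (θ : Coeff) (i : Fin m) :
    Measure (List Bool) :=
  (observationLaw σ θ).bind (T.transcript i)

instance (T : DistributedEstimator m) (i : Fin m) : IsMarkovKernel (T.transcript i) :=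
  T.isMarkovKernel_transcript i

instance (T : DistributedEstimator m) : IsMarkovKernel T.estimate :=
  T.isMarkovKernel_estimate

instance (T : DistributedEstimator m) (σ : ℝ) (θ : Coeff) (i : Fin m) :
    IsProbabilityMeasure (T.wordLaw σ θ i) := by
  unfold wordLaw; infer_instance

theorem transcriptLaw_eq (T : DistributedEstimator m) (σ : ℝ) (θ : Coeff) :
    T.transcriptLaw σ θ = Measure.pi (T.wordLaw σ θ) := rfl

instance (T : DistributedEstimator m) (σ : ℝ) (θ : Coeff) :
    IsProbabilityMeasure (T.transcriptLaw σ θ) := by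
  rw [transcriptLaw_eq]; infer_instance

theorem wordLaw_ae_mem_code (T : DistributedEstimator m) (σ : ℝ) (θ : Coeff) (i : Fin m) :
    ∀ᵐ z ∂T.wordLaw σ θ i, z ∈ T.code i := by
  have hc : MeasurableSet (T.code i)ᶜ := trivial
  rw [ae_iff]
  change (T.wordLaw σ θ i) (T.code i)ᶜ = 0
  rw [wordLaw, Measure.bind_apply hc (T.transcript i).measurable.aemeasurable]
  rw [lintegral_eq_zero_iff ((T.transcript i).measurable_coe hc)]
  exact Filter.Eventually.of_forall fun x => T.transcript_mem_code i x

/-- The mean squared error in a single coefficient. -/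
noncomputable def coordRisk (T : DistributedEstimator m) (σ : ℝ) (θ : Coeff) (k : Idx) : ℝ≥0∞ :=
  ∫⁻ t, ENNReal.ofReal ((t k - θ k) ^ 2) ∂T.estimateLaw σ θ

theorem measurable_sq_error (a : ℝ) (k : Idx) :
    Measurable fun t : Coeff => ENNReal.ofReal ((t k - a) ^ 2) :=
  have h : Measurable fun t : Coeff => t k := measurable_pi_apply k
  ((h.sub_const a).pow_const 2).ennreal_ofReal

theorem sum_coordRisk_le_risk (T : DistributedEstimator m) (σ : ℝ) (θ : Coeff) (I : Finset Idx) :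
    ∑ k ∈ I, T.coordRisk σ θ k ≤ T.risk σ θ := by
  unfold coordRisk risk
  rw [← lintegral_finsetSum _ fun k _ => measurable_sq_error _ k]
  exact lintegral_mono fun t => ENNReal.sum_le_tsum I

/-- Le Cam's two-point bound. -/
theorem sum_min_le_coordRisk_add (T : DistributedEstimator m) (σ : ℝ) (θ θ' : Coeff) (k : Idx)
    {δ : ℝ} (hθ : θ k ^ 2 = δ ^ 2) (hθ' : θ' k = - θ k)
    (S : Finset (Fin m → List Bool)) :
    ENNReal.ofReal (2 * δ ^ 2 * ∑ z ∈ S, min (∏ i, (T.wordLaw σ θ i).real {z i})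
        (∏ i, (T.wordLaw σ θ' i).real {z i})) ≤
      T.coordRisk σ θ k + T.coordRisk σ θ' k := by
  have hms := measurable_sq_error
  have h1 : ∀ ϑ : Coeff, ∑ z ∈ S, (∫⁻ t, ENNReal.ofReal ((t k - ϑ k) ^ 2) ∂T.estimate z) *
      ENNReal.ofReal (∏ i, (T.wordLaw σ ϑ i).real {z i}) ≤ T.coordRisk σ ϑ k := by
    intro ϑ
    unfold coordRisk estimateLaw
    rw [Measure.lintegral_bind T.estimate.measurable.aemeasurable (hms _ k).aemeasurable]
    refine le_trans (le_of_eq ?_) (sum_mul_measure_singleton_le _ S _)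
    refine Finset.sum_congr rfl fun z _ => ?_
    rw [transcriptLaw_eq, Measure.pi_singleton,
      ENNReal.ofReal_prod_of_nonneg fun i _ => measureReal_nonneg]
    congr 1
    exact Finset.prod_congr rfl fun i _ => ofReal_measureReal
  refine le_trans ?_ (add_le_add (h1 θ) (h1 θ'))
  rw [← Finset.sum_add_distrib, Finset.mul_sum, ENNReal.ofReal_sum_of_nonneg fun z _ =>
    mul_nonneg (by positivity) (le_min (Finset.prod_nonneg fun i _ => measureReal_nonneg)
      (Finset.prod_nonneg fun i _ => measureReal_nonneg))]
  refine Finset.sum_le_sum fun z _ => ?_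
  set a := ∏ i, (T.wordLaw σ θ i).real {z i}
  set b := ∏ i, (T.wordLaw σ θ' i).real {z i}
  rw [ENNReal.ofReal_mul (by positivity)]
  have h2 : ENNReal.ofReal (2 * δ ^ 2) ≤ (∫⁻ t, ENNReal.ofReal ((t k - θ k) ^ 2) ∂T.estimate z) +
      ∫⁻ t, ENNReal.ofReal ((t k - θ' k) ^ 2) ∂T.estimate z := by
    rw [← lintegral_add_left (hms _ k)]
    calc ENNReal.ofReal (2 * δ ^ 2) = ∫⁻ _, ENNReal.ofReal (2 * δ ^ 2) ∂T.estimate z := by simp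
      _ ≤ _ := by
        refine lintegral_mono fun t => ?_
        rw [← ENNReal.ofReal_add (sq_nonneg _) (sq_nonneg _), hθ', ← hθ]
        exact ENNReal.ofReal_le_ofReal (by nlinarith [sq_nonneg (t k)])
  calc _ ≤ _ := mul_le_mul_left h2 _
    _ = _ := add_mul _ _ _
    _ ≤ _ := by gcongr; exacts [min_le_left _ _, min_le_right _ _]

/-- Finitely many codewords carry almost all the mass of finitely many transcript laws. -/
theorem exists_finset_codewords (T : DistributedEstimator m) (σ : ℝ) (i : Fin m)
    (Θ : Finset Coeff) {ε : ℝ} (hε : 0 < ε) :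
    ∃ S : Finset (List Bool), (S : Set (List Bool)) ⊆ T.code i ∧
      ∀ θ ∈ Θ, 1 - ε ≤ ∑ z ∈ S, (T.wordLaw σ θ i).real {z} := by
  classical
  have h1 : ∀ θ, ∃ S : Finset (List Bool),
      1 - ε ≤ (T.wordLaw σ θ i).real (S : Set (List Bool)) := by
    intro θ
    have h2 : ∑' z, T.wordLaw σ θ i {z} = 1 := by
      have := (T.wordLaw σ θ i).tsum_indicator_apply_singleton Set.univ MeasurableSet.univ
      simpa using this
    have h3 : ENNReal.ofReal (1 - ε) < ∑' z, T.wordLaw σ θ i {z} := by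
      rw [h2, ENNReal.ofReal_lt_one]; linarith
    rw [ENNReal.tsum_eq_iSup_sum, lt_iSup_iff] at h3
    obtain ⟨S, hS⟩ := h3
    refine ⟨S, ?_⟩
    rw [sum_measure_singleton] at hS
    rw [measureReal_def, ← ENNReal.ofReal_le_iff_le_toReal (measure_ne_top _ _)]
    exact hS.le
  choose S hS using h1
  refine ⟨(Θ.biUnion S).filter (· ∈ T.code i), fun z hz => (Finset.mem_filter.1 hz).2,
    fun θ hθ => ?_⟩
  rw [sum_measureReal_singleton]
  refine (hS θ).trans ?_
  rw [measureReal_def, measureReal_def]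
  refine ENNReal.toReal_mono (measure_ne_top _ _) (measure_mono_ae ?_)
  filter_upwards [T.wordLaw_ae_mem_code σ θ i] with z hz hzS
  change z ∈ ((Θ.biUnion S).filter (· ∈ T.code i) : Set (List Bool))
  rw [Finset.mem_coe, Finset.mem_filter, Finset.mem_biUnion]
  exact ⟨⟨θ, hθ, hzS⟩, hz⟩

end DistributedEstimator

/-! ### Long words over a cube -/

namespace DistributedEstimator

variable {m : ℕ}

/-- An estimator whose risk is at most an eighth of the squared half-diagonal `|I| δ²` of the cube
has transcripts that separate, on average, the endpoints of the edges of the cube. -/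
theorem le_sum_hellingerPos_of_risk_le (T : DistributedEstimator m) (hm : 0 < m) (σ : ℝ)
    (I : Finset Idx) {δ : ℝ} (hδ : 0 < δ)
    (hrisk : ∀ u ⊆ I, T.risk σ (vertex I δ u) ≤ ENNReal.ofReal (I.card * δ ^ 2 / 8)) :
    ∃ S : Fin m → Finset (List Bool), (∀ i, (S i : Set (List Bool)) ⊆ T.code i) ∧
      (2 ^ I.card * I.card / 4 : ℝ) ≤ ∑ u ∈ I.powerset, ∑ i, ∑ k ∈ I, ∑ z ∈ S i,
        hellingerPos ((T.wordLaw σ (vertex I δ u) i).real {z})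
          ((T.wordLaw σ (vertex I δ (symmDiff u {k})) i).real {z}) := by
  classical
  -- the mass missing from the finite sets of words then costs `∑ i, 2 ε = 1 / 4`
  set ε : ℝ := 1 / (8 * m) with hε
  have hm' : (0 : ℝ) < m := Nat.cast_pos.2 hm
  have hε0 : 0 < ε := by positivity
  choose S hSc hSm using fun i =>
    T.exists_finset_codewords σ i (I.powerset.image (vertex I δ)) hε0
  refine ⟨S, hSc, ?_⟩
  set p : Finset Idx → Fin m → List Bool → ℝ :=
    fun u i z => (T.wordLaw σ (vertex I δ u) i).real {z} with hp
  have hp0 : ∀ u i z, 0 ≤ p u i z := fun u i z => measureReal_nonneg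
  have hp1 : ∀ u i, ∑ z ∈ S i, p u i z ≤ 1 := fun u i => by
    simp only [hp]; rw [sum_measureReal_singleton]; exact measureReal_le_one
  have hpε : ∀ u ∈ I.powerset, ∀ i, 1 - ε ≤ ∑ z ∈ S i, p u i z := fun u hu i =>
    hSm i _ (Finset.mem_image_of_mem _ hu)
  have hflip : ∀ u ∈ I.powerset, ∀ k ∈ I, symmDiff u {k} ∈ I.powerset := fun u hu k hk => by
    rw [Finset.mem_powerset] at hu ⊢
    intro i hi
    rcases Finset.mem_symmDiff.1 hi with h | h
    · exact hu h.1
    · rw [Finset.mem_singleton.1 h.1]; exact hk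
  set H : Finset Idx → Idx → ℝ := fun u k =>
    ∑ i, ∑ z ∈ S i, (√(p u i z) - √(p (symmDiff u {k}) i z)) ^ 2 with hH
  set R : Finset Idx → Idx → ℝ≥0∞ := fun u k => T.coordRisk σ (vertex I δ u) k with hR
  have htwo : ∀ u ∈ I.powerset, ∀ k ∈ I,
      ENNReal.ofReal (δ ^ 2 * (3 / 4 - H u k)) ≤ R u k + R (symmDiff u {k}) k := by
    intro u hu k hk
    refine le_trans (ENNReal.ofReal_le_ofReal ?_) (T.sum_min_le_coordRisk_add σ (vertex I δ u)
      (vertex I δ (symmDiff u {k})) k (vertex_sq δ u hk) (vertex_symmDiff_self I δ u)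
      (Fintype.piFinset S))
    have h := one_sub_le_two_mul_sum_min S (p u) (p (symmDiff u {k})) ε (hp0 _) (hp0 _) (hp1 _)
      (hp1 _) (hpε u hu) (hpε _ (hflip u hu k hk))
    rw [Finset.sum_add_distrib] at h
    have e : ∑ _i : Fin m, 2 * ε = 1 / 4 := by
      rw [Finset.sum_const, Finset.card_univ, Fintype.card_fin, nsmul_eq_mul, hε]
      field_simp; norm_num
    rw [e] at h
    have h' : 3 / 4 - H u k ≤ 2 * ∑ z ∈ Fintype.piFinset S,
        min (∏ i, p u i (z i)) (∏ i, p (symmDiff u {k}) i (z i)) := by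
      simp only [hH]; linarith
    calc _ ≤ _ := mul_le_mul_of_nonneg_left h' (sq_nonneg δ)
      _ = _ := by ring
  have hcard : (I.powerset.card : ℝ) = 2 ^ I.card := by rw [Finset.card_powerset]; push_cast; rfl
  have hup : ∑ u ∈ I.powerset, ∑ k ∈ I, (R u k + R (symmDiff u {k}) k) ≤
      ENNReal.ofReal (2 ^ I.card * (I.card * δ ^ 2 / 4)) := by
    have h1 : ∑ u ∈ I.powerset, ∑ k ∈ I, R u k ≤
        ENNReal.ofReal (2 ^ I.card * (I.card * δ ^ 2 / 8)) := by
      calc ∑ u ∈ I.powerset, ∑ k ∈ I, R u k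
          ≤ ∑ u ∈ I.powerset, ENNReal.ofReal (I.card * δ ^ 2 / 8) :=
            Finset.sum_le_sum fun u hu => (T.sum_coordRisk_le_risk σ _ I).trans
              (hrisk u (Finset.mem_powerset.1 hu))
        _ = _ := by
            rw [← ENNReal.ofReal_sum_of_nonneg fun _ _ => by positivity, Finset.sum_const,
              nsmul_eq_mul, hcard]
    simp_rw [Finset.sum_add_distrib]
    rw [sum_powerset_sum_symmDiff_singleton I R]
    refine (add_le_add h1 h1).trans_eq ?_
    rw [← ENNReal.ofReal_add (by positivity) (by positivity)]
    congr 1; ring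
  have hreal : δ ^ 2 * ∑ u ∈ I.powerset, ∑ k ∈ I, (3 / 4 - H u k) ≤
      2 ^ I.card * (I.card * δ ^ 2 / 4) := by
    rw [← ENNReal.ofReal_le_ofReal_iff (by positivity)]
    refine le_trans ?_ hup
    simp_rw [Finset.mul_sum]
    refine (ofReal_sum_le _ _).trans (Finset.sum_le_sum fun u hu => ?_)
    exact (ofReal_sum_le _ _).trans (Finset.sum_le_sum fun k hk => htwo u hu k hk)
  set B : Finset Idx → Idx → ℝ := fun u k =>
    ∑ i, ∑ z ∈ S i, hellingerPos (p u i z) (p (symmDiff u {k}) i z) with hB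
  have hHB : ∀ u k, H u k = B u k + B (symmDiff u {k}) k := fun u k => by
    simp only [hH, hB]
    rw [← Finset.sum_add_distrib]
    refine Finset.sum_congr rfl fun i _ => ?_
    rw [← Finset.sum_add_distrib]
    refine Finset.sum_congr rfl fun z _ => ?_
    rw [symmDiff_symmDiff_cancel_right, hellingerPos_add_swap]
  have hH2 : ∑ u ∈ I.powerset, ∑ k ∈ I, H u k = 2 * ∑ u ∈ I.powerset, ∑ k ∈ I, B u k := by
    simp_rw [hHB, Finset.sum_add_distrib]
    rw [sum_powerset_sum_symmDiff_singleton I B, two_mul]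
  have hgoal : ∑ u ∈ I.powerset, ∑ i, ∑ k ∈ I, ∑ z ∈ S i,
      hellingerPos (p u i z) (p (symmDiff u {k}) i z) = ∑ u ∈ I.powerset, ∑ k ∈ I, B u k :=
    Finset.sum_congr rfl fun u _ => Finset.sum_comm
  rw [hgoal]
  simp_rw [Finset.sum_sub_distrib] at hreal
  rw [hH2, Finset.sum_const, Finset.sum_const, nsmul_eq_mul, nsmul_eq_mul, hcard] at hreal
  have hδ2 : 0 < δ ^ 2 := by positivity
  have : 2 ^ I.card * (I.card * (3 / 4 : ℝ)) - 2 * ∑ u ∈ I.powerset, ∑ k ∈ I, B u k ≤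
      2 ^ I.card * (I.card / 4) := by
    refine le_of_mul_le_mul_left (hreal.trans_eq ?_) hδ2
    ring
  linarith

/-- A protocol of small risk over the cube often sends long words: words longer than a fixed
multiple of the dimension of the cube have, on average over the machines and over the vertices,
probability bounded below. -/
theorem le_sum_prob_long_of_risk_le (T : DistributedEstimator m) (hm : 0 < m) {σ : ℝ} (hσ : 0 < σ)
    (I : Finset Idx) {β κ s δ : ℝ} (hβ : 0 < β) (hκ : κ = 4 * Real.exp (4 * β))
    (hs : s = 384 * Real.exp κ * β) (hδ : 0 < δ)
    (hδβ : δ ^ 2 = β * σ ^ 2 / m) (hI : 64 * κ * β ≤ I.card)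
    (hrisk : ∀ u ⊆ I, T.risk σ (vertex I δ u) ≤ ENNReal.ofReal (I.card * δ ^ 2 / 8)) :
    2 ^ I.card * (m / (16 * β * s)) ≤ ∑ u ∈ I.powerset, ∑ i,
      (T.wordLaw σ (vertex I δ u) i).real {z | I.card / (64 * κ * β) < z.length} := by
  classical
  obtain ⟨S, hSc, hS⟩ := T.le_sum_hellingerPos_of_risk_le hm σ I hδ hrisk
  have hm' : (0 : ℝ) < m := Nat.cast_pos.2 hm
  have hm1 : (1 : ℝ) ≤ m := Nat.one_le_cast.2 hm
  have hκ0 : 0 < κ := by rw [hκ]; positivity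
  have hs0 : 0 < s := by rw [hs]; positivity
  set ρ := β / m with hρ
  have hρ0 : 0 < ρ := by positivity
  have hρβ : ρ ≤ β := div_le_self hβ.le hm1
  set t : ℝ := I.card / (64 * κ * β) with ht
  have ht0 : 0 ≤ t := by positivity
  have hone : ∀ u : Finset Idx, ∀ i, ∑ k ∈ I, ∑ z ∈ S i,
      hellingerPos ((T.wordLaw σ (vertex I δ u) i).real {z})
        ((T.wordLaw σ (vertex I δ (symmDiff u {k})) i).real {z}) ≤
      4 * (κ * ρ) * (t + 1) + I.card * (ρ * (s * (T.wordLaw σ (vertex I δ u) i).real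
        {z | t < z.length} + 24 / s * Real.exp κ)) := by
    intro u i
    -- the likelihood ratio of the flip of coordinate `k`
    set d : Idx → ℝ := fun k => if k ∈ u then -(2 * δ) else 2 * δ with hd
    have hd2 : ∀ k, d k ^ 2 = 4 * ρ * σ ^ 2 := fun k => by
      have : d k ^ 2 = 4 * δ ^ 2 := by simp only [hd]; split_ifs <;> ring
      rw [this, hδβ, hρ]; ring
    set f : Idx → Coeff → ℝ := fun k x => gaussianLR σ (vertex I δ u k) (d k) (x k) with hf
    have hfm : ∀ k, Measurable (f k) := fun k =>
      (measurable_gaussianLR _ _ _).comp (measurable_pi_apply k)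
    have hlaw : ∀ k, ∃ θ, (observationLaw σ (vertex I δ u)).withDensity
        (fun x => ENNReal.ofReal (f k x)) = observationLaw σ θ := fun k => by
      refine ⟨Function.update (vertex I δ u) k (vertex I δ u k + d k), ?_⟩
      rw [observationLaw_eq_withDensity hσ (vertex I δ u)
        (Function.update (vertex I δ u) k (vertex I δ u k + d k)) {k} fun i hi =>
          Function.update_of_ne (by simpa using hi) _ _]
      simp [hf]
    have hflip : ∀ k ∈ I, (observationLaw σ (vertex I δ u)).withDensity
        (fun x => ENNReal.ofReal (f k x)) = observationLaw σ (vertex I δ (symmDiff u {k})) := by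
      intro k hk
      rw [observationLaw_eq_withDensity hσ (vertex I δ u) (vertex I δ (symmDiff u {k})) {k}
        fun i hi => vertex_symmDiff_of_ne I δ u (by simpa using hi)]
      have : vertex I δ (symmDiff u {k}) k - vertex I δ u k = d k := by
        rw [vertex_symmDiff_self]
        simp only [vertex, hk, if_true, hd]
        split_ifs <;> ring
      simp [hf, this]
    have : ∀ k, IsProbabilityMeasure ((observationLaw σ (vertex I δ u)).withDensity
        fun x => ENNReal.ofReal (f k x)) := fun k => by
      obtain ⟨θ, hθ⟩ := hlaw k
      rw [hθ]; infer_instance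
    have h := sum_hellingerPos_le (T.transcript i) I f hfm (fun k x => (gaussianLR_pos _ _ _ _).le)
      hκ0 hρ0 hs0 ht0 (fun l hl => by
        rw [hκ]
        exact integral_exp_sum_one_sub_gaussianLR_le hσ (vertex I δ u) I d hd2 hρ0.le hρβ l hl)
      (S i) fun L₁ L₂ h1 h2 => T.uniquelyDecodable i L₁ L₂ (fun w hw => hSc i (h1 w hw))
        fun w hw => hSc i (h2 w hw)
    refine le_trans (le_of_eq ?_) h
    refine Finset.sum_congr rfl fun k hk => Finset.sum_congr rfl fun z _ => ?_
    rw [hflip k hk]; rfl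
  have hsum := hS.trans (Finset.sum_le_sum fun u _ => Finset.sum_le_sum fun i _ => hone u i)
  have hcard : (I.powerset.card : ℝ) = 2 ^ I.card := by rw [Finset.card_powerset]; push_cast; rfl
  simp_rw [mul_add, Finset.sum_add_distrib, ← Finset.mul_sum] at hsum
  simp only [Finset.sum_const, Finset.card_univ, Fintype.card_fin, nsmul_eq_mul, hcard] at hsum
  set X := ∑ u ∈ I.powerset, ∑ i, (T.wordLaw σ (vertex I δ u) i).real {z | t < z.length}
  set N : ℝ := 2 ^ I.card with hN
  have hN0 : 0 < N := by positivity
  -- the constants make three of the four contributions a sixteenth each, against a need of a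
  -- quarter; the last sixteenth is left to the probability of the long words
  have e1 : N * (m * (4 * (κ * ρ) * t)) = N * I.card / 16 := by
    rw [ht, hρ]; field_simp; ring
  have e2 : N * (m * (4 * (κ * ρ) * 1)) ≤ N * I.card / 16 := by
    have : N * (m * (4 * (κ * ρ) * 1)) = N * (64 * κ * β) / 16 := by
      rw [hρ]; field_simp; ring
    rw [this]; gcongr
  have e3 : N * (m * (I.card * (ρ * (24 / s * Real.exp κ)))) = N * I.card / 16 := by
    rw [hs, hρ]; field_simp; ring
  have hI0 : (0 : ℝ) < I.card := lt_of_lt_of_le (by positivity) hI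
  have e4 : N * I.card / 16 ≤ I.card * (ρ * (s * X)) := by
    linarith
  have e5 : N / 16 ≤ ρ * (s * X) := by
    refine le_of_mul_le_mul_left ?_ hI0
    linarith
  have e6 : ρ * (s * X) = X * (β * s / m) := by rw [hρ]; ring
  rw [e6, ← div_le_iff₀ (by positivity)] at e5
  refine le_trans (le_of_eq ?_) e5
  field_simp

/-- Under the uniform mixture over the vertices, one machine cannot tell the cube from its centre
better than the `χ²`-divergence permits, which is bounded as long as `|I| (δ / σ)⁴` is. -/
theorem sum_vertex_prob_le (T : DistributedEstimator m) {σ : ℝ} (hσ : 0 < σ) (I : Finset Idx)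
    (δ : ℝ) (i : Fin m) (A : Set (List Bool)) {w : ℝ} (hw : 0 < w) :
    ∑ u ∈ I.powerset, (T.wordLaw σ (vertex I δ u) i).real A ≤ 2 ^ I.card *
      (w * (T.wordLaw σ 0 i).real A + Real.exp (I.card * δ ^ 4 / (2 * σ ^ 4)) / w) := by
  classical
  set P := observationLaw σ 0 with hP
  have hA : MeasurableSet A := trivial
  set τ : Coeff → ℝ := fun x => (T.transcript i x).real A with hτ
  have hτm : Measurable τ := ((T.transcript i).measurable_coe hA).ennreal_toReal
  have hτ0 : ∀ x, 0 ≤ τ x := fun x => measureReal_nonneg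
  have hτ1 : ∀ x, τ x ≤ 1 := fun x => measureReal_le_one
  have hτb : ∀ᵐ x ∂P, ‖τ x‖ ≤ 1 :=
    Filter.Eventually.of_forall fun x => by rw [Real.norm_of_nonneg (hτ0 x)]; exact hτ1 x
  have hτi : Integrable τ P := Integrable.of_bound hτm.aestronglyMeasurable 1 hτb
  set G := gaussianReal 0 (Real.toNNReal (σ ^ 2)) with hG
  set f : Finset Idx → Coeff → ℝ := fun u x => ∏ k ∈ I, gaussianLR σ 0 (vertex I δ u k) (x k)
    with hf
  have hfm : ∀ u, Measurable (f u) := fun u => Finset.measurable_prod _ fun k _ =>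
    (measurable_gaussianLR _ _ _).comp (measurable_pi_apply k)
  have hf0 : ∀ u x, 0 ≤ f u x := fun u x =>
    Finset.prod_nonneg fun k _ => (gaussianLR_pos _ _ _ _).le
  have hlaw : ∀ u, observationLaw σ (vertex I δ u) = P.withDensity
      fun x => ENNReal.ofReal (f u x) := fun u => by
    rw [observationLaw_eq_withDensity hσ 0 (vertex I δ u) I fun k hk => by simp [vertex, hk]]
    simp [hf, hP]
  have hpr : ∀ u, IsProbabilityMeasure (P.withDensity fun x => ENNReal.ofReal (f u x)) :=
    fun u => by rw [← hlaw u]; infer_instance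
  have hfi : ∀ u, Integrable (f u) P := fun u => by
    refine ⟨(hfm u).aestronglyMeasurable, ?_⟩
    rw [hasFiniteIntegral_iff_ofReal (Filter.Eventually.of_forall (hf0 u))]
    have := measure_univ (μ := P.withDensity fun x => ENNReal.ofReal (f u x))
    rw [withDensity_apply _ MeasurableSet.univ, Measure.restrict_univ] at this
    rw [this]; exact ENNReal.one_lt_top
  -- the mixture density factorizes
  set g : ℝ → ℝ := fun x => (gaussianLR σ 0 δ x + gaussianLR σ 0 (-δ) x) / 2 with hg
  have hgm : Measurable g :=
    ((measurable_gaussianLR _ _ _).add (measurable_gaussianLR _ _ _)).div_const 2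
  set M : Coeff → ℝ := fun x => ∏ k ∈ I, g (x k) with hM
  have hMm : Measurable M := Finset.measurable_prod _ fun k _ => hgm.comp (measurable_pi_apply k)
  have hmix : ∀ x, ∑ u ∈ I.powerset, f u x = 2 ^ I.card * M x := fun x => by
    have h1 : 2 ^ I.card * M x = ∏ k ∈ I, (gaussianLR σ 0 δ (x k) + gaussianLR σ 0 (-δ) (x k)) := by
      rw [← Finset.prod_const, hM, ← Finset.prod_mul_distrib]
      exact Finset.prod_congr rfl fun k _ => by simp only [hg]; ring
    rw [h1, Finset.prod_add]
    refine Finset.sum_congr rfl fun u hu => ?_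
    have hu' := Finset.mem_powerset.1 hu
    simp only [hf]
    rw [← Finset.prod_sdiff hu', mul_comm]
    congr 1
    · exact Finset.prod_congr rfl fun k hk => by simp [vertex, hu' hk, hk]
    · refine Finset.prod_congr rfl fun k hk => ?_
      have := Finset.mem_sdiff.1 hk
      simp [vertex, this.1, this.2]
  have hσ2 : σ ^ 2 ≠ 0 := by positivity
  set r := δ ^ 2 / σ ^ 2 with hr
  have hg2 : ∀ x, g x ^ 2 = Real.exp r / 4 * gaussianLR σ 0 (2 * δ) x +
      (Real.exp r / 4 * gaussianLR σ 0 (2 * -δ) x + Real.exp (-r) / 2) := by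
    intro x
    have hsq : ∀ d, d ^ 2 = δ ^ 2 → gaussianLR σ 0 d x ^ 2 =
        Real.exp r * gaussianLR σ 0 (2 * d) x := by
      intro d hd
      have := gaussianLR_rpow σ 0 d 2 x
      have e : (2 ^ 2 - 2) * d ^ 2 / (2 * σ ^ 2) = r := by rw [hd, hr]; field_simp; ring
      rw [e] at this
      rw [← this, gaussianLR, ← Real.exp_nat_mul]
      norm_num
    have hx : gaussianLR σ 0 δ x * gaussianLR σ 0 (-δ) x = Real.exp (-r) := by
      unfold gaussianLR
      rw [← Real.exp_add, hr]
      congr 1; field_simp; ring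
    have h1 := hsq δ rfl
    have h2 := hsq (-δ) (by ring)
    simp only [hg]
    linear_combination (1 / 4) * h1 + (1 / 4) * h2 + (1 / 2) * hx
  have hi1 := (integrable_gaussianLR hσ 0 (2 * δ)).const_mul (Real.exp r / 4)
  have hi2 := (integrable_gaussianLR hσ 0 (2 * -δ)).const_mul (Real.exp r / 4)
  have hi3 : Integrable
      (fun x => Real.exp r / 4 * gaussianLR σ 0 (2 * -δ) x + Real.exp (-r) / 2) G :=
    hi2.add (integrable_const _)
  have hgi : Integrable (fun x => g x ^ 2) G := by
    simp_rw [hg2]; exact hi1.add hi3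
  have hgint : ∫ x, g x ^ 2 ∂G ≤ Real.exp (δ ^ 4 / (2 * σ ^ 4)) := by
    simp_rw [hg2]
    rw [integral_add hi1 hi3, integral_add hi2 (integrable_const _), integral_const_mul,
      integral_const_mul, integral_gaussianLR hσ, integral_gaussianLR hσ]
    simp only [integral_const, probReal_univ, smul_eq_mul]
    have := Real.cosh_le_exp_half_sq r
    rw [Real.cosh_eq] at this
    have e : r ^ 2 / 2 = δ ^ 4 / (2 * σ ^ 4) := by rw [hr]; field_simp
    rw [e] at this
    linarith
  have hMl : ∫⁻ x, ENNReal.ofReal (M x ^ 2) ∂P ≤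
      ENNReal.ofReal (Real.exp (I.card * δ ^ 4 / (2 * σ ^ 4))) := by
    have h1 : ∀ x, ENNReal.ofReal (M x ^ 2) = ∏ k ∈ I, ENNReal.ofReal (g (x k) ^ 2) := fun x => by
      rw [← ENNReal.ofReal_prod_of_nonneg fun k _ => sq_nonneg _, Finset.prod_pow]
    simp_rw [h1]
    rw [hP, lintegral_prod_observationLaw σ 0 I (fun _ x => ENNReal.ofReal (g x ^ 2))
      fun _ => (hgm.pow_const 2).ennreal_ofReal]
    have e : I.card * δ ^ 4 / (2 * σ ^ 4) = I.card * (δ ^ 4 / (2 * σ ^ 4)) := by ring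
    rw [e, Real.exp_nat_mul, ENNReal.ofReal_pow (Real.exp_pos _).le, ← Finset.prod_const]
    refine Finset.prod_le_prod' fun k _ => ?_
    change ∫⁻ x, ENNReal.ofReal (g x ^ 2) ∂G ≤ _
    rw [← ofReal_integral_eq_lintegral_ofReal hgi
      (Filter.Eventually.of_forall fun x => sq_nonneg _)]
    exact ENNReal.ofReal_le_ofReal hgint
  have hM2i : Integrable (fun x => M x ^ 2) P := by
    refine ⟨(hMm.pow_const 2).aestronglyMeasurable, ?_⟩
    rw [hasFiniteIntegral_iff_ofReal (Filter.Eventually.of_forall fun x => sq_nonneg _)]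
    exact hMl.trans_lt ENNReal.ofReal_lt_top
  have hM2 : ∫ x, M x ^ 2 ∂P ≤ Real.exp (I.card * δ ^ 4 / (2 * σ ^ 4)) := by
    rw [integral_eq_lintegral_of_nonneg_ae (Filter.Eventually.of_forall fun x => sq_nonneg _)
      (hMm.pow_const 2).aestronglyMeasurable]
    exact ENNReal.toReal_le_of_le_ofReal (Real.exp_pos _).le hMl
  have hu : ∀ u, (T.wordLaw σ (vertex I δ u) i).real A = ∫ x, τ x * f u x ∂P := fun u => by
    unfold wordLaw
    rw [hlaw u]
    exact bind_withDensity_real_apply (T.transcript i) hA (hfm u) (hf0 u)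
  have h0 : (T.wordLaw σ 0 i).real A = ∫ x, τ x ∂P := bind_real_apply (T.transcript i) hA
  have hτf : ∀ u, Integrable (fun x => τ x * f u x) P := fun u =>
    (hfi u).bdd_mul hτm.aestronglyMeasurable hτb
  simp_rw [hu]
  rw [h0, ← integral_finsetSum _ fun u _ => hτf u]
  have hpt : ∀ x, ∑ u ∈ I.powerset, τ x * f u x ≤ 2 ^ I.card * (w * τ x + 1 / w * M x ^ 2) := by
    intro x
    rw [← Finset.mul_sum, hmix]
    have h1 : τ x * M x ≤ w * τ x + 1 / w * M x ^ 2 := by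
      have e : w * τ x + 1 / w * M x ^ 2 = (w ^ 2 * τ x + M x ^ 2) / w := by field_simp
      rw [e, le_div_iff₀ hw]
      have a := hτ0 x
      have b := hτ1 x
      nlinarith [sq_nonneg (w - M x), mul_le_mul_of_nonneg_right b (sq_nonneg (M x)),
        mul_nonneg a (sq_nonneg (w - M x)), mul_nonneg a (sq_nonneg w)]
    calc _ = 2 ^ I.card * (τ x * M x) := by ring
      _ ≤ _ := by gcongr
  refine (integral_mono (integrable_finsetSum _ fun u _ => hτf u)
    (((hτi.const_mul _).add (hM2i.const_mul _)).const_mul _) hpt).trans ?_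
  simp only [Pi.add_apply]
  rw [integral_const_mul, integral_add (hτi.const_mul _) (hM2i.const_mul _), integral_const_mul,
    integral_const_mul]
  have : 1 / w * ∫ x, M x ^ 2 ∂P ≤ Real.exp (I.card * δ ^ 4 / (2 * σ ^ 4)) / w := by
    rw [one_div, div_eq_inv_mul]; gcongr
  gcongr

/-- Markov's inequality for the lengths of the words. -/
theorem mul_sum_prob_long_le (T : DistributedEstimator m) (σ : ℝ) (θ : Coeff) {t : ℝ} (ht : 0 ≤ t) :
    ENNReal.ofReal (t * ∑ i, (T.wordLaw σ θ i).real {z | t < z.length}) ≤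
      T.expectedCommunication σ θ := by
  have hlen : Measurable fun z : List Bool => (z.length : ℝ≥0∞) := fun _ _ => trivial
  have h1 : T.expectedCommunication σ θ =
      ∑ i, ∫⁻ z, (z.length : ℝ≥0∞) ∂T.wordLaw σ θ i := by
    unfold expectedCommunication
    rw [lintegral_finsetSum _ fun i _ => show Measurable fun z : Fin m → List Bool =>
      ((z i).length : ℝ≥0∞) from hlen.comp (measurable_pi_apply i)]
    refine Finset.sum_congr rfl fun i _ => ?_
    rw [transcriptLaw_eq]
    exact (measurePreserving_eval (T.wordLaw σ θ) i).lintegral_comp hlen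
  rw [h1, Finset.mul_sum, ENNReal.ofReal_sum_of_nonneg fun i _ => by positivity]
  refine Finset.sum_le_sum fun i _ => ?_
  rw [ENNReal.ofReal_mul ht, ofReal_measureReal]
  refine le_trans ?_ (mul_meas_ge_le_lintegral hlen (ENNReal.ofReal t))
  gcongr
  intro hz
  rw [← ENNReal.ofReal_natCast]
  exact ENNReal.ofReal_le_ofReal (le_of_lt hz)

/-- Every machine sends at least one bit. -/
theorem machines_le_expectedCommunication (T : DistributedEstimator m) (σ : ℝ) (θ : Coeff) :
    (m : ℝ≥0∞) ≤ T.expectedCommunication σ θ := by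
  have hne : ∀ i, ∀ᵐ z ∂T.wordLaw σ θ i, z ≠ [] := fun i => by
    filter_upwards [T.wordLaw_ae_mem_code σ θ i] with z hz h
    exact (T.uniquelyDecodable i).epsilon_not_mem (h ▸ hz)
  have hae : ∀ᵐ z ∂T.transcriptLaw σ θ, ∀ i, z i ≠ [] := by
    rw [ae_all_iff]
    intro i
    rw [transcriptLaw_eq]
    exact (measurePreserving_eval (T.wordLaw σ θ) i).quasiMeasurePreserving.ae (hne i)
  unfold expectedCommunication
  calc (m : ℝ≥0∞) = ∫⁻ _, (m : ℝ≥0∞) ∂T.transcriptLaw σ θ := by simp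
    _ ≤ _ := by
      refine lintegral_mono_ae ?_
      filter_upwards [hae] with z hz
      calc (m : ℝ≥0∞) = ∑ _i : Fin m, 1 := by simp
        _ ≤ _ := Finset.sum_le_sum fun i _ => by
          exact_mod_cast List.length_pos_iff.2 (hz i)

end DistributedEstimator

/-! ### Cubes inside Besov classes -/

/-- The positions of level `j`. -/
def level (j : ℕ) : Finset Idx := Finset.univ.map ⟨fun k : Fin (2 ^ j) => (⟨j, k⟩ : Idx),
  fun _ _ h => eq_of_heq (Sigma.mk.inj h).2⟩

theorem card_level (j : ℕ) : (level j).card = 2 ^ j := by simp [level]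

theorem mem_level {j : ℕ} {i : Idx} : i ∈ level j ↔ i.1 = j := by
  obtain ⟨j', k⟩ := i
  simp only [level, Finset.mem_map, Finset.mem_univ, true_and]
  constructor
  · rintro ⟨k', h⟩; exact (Sigma.mk.inj h).1.symm
  · intro h
    change j' = j at h
    subst h; exact ⟨k, rfl⟩

theorem ellNorm_const {ι : Type} [Fintype ι] [Nonempty ι] {p : ℝ≥0∞} (hp : 0 < p) (c : ℝ≥0∞) :
    ellNorm p (fun _ : ι => c) = (Fintype.card ι : ℝ≥0∞) ^ (p⁻¹).toReal * c := by
  unfold ellNorm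
  split_ifs with h
  · simp [h]
  · have hp' : 0 < p.toReal := ENNReal.toReal_pos hp.ne' h
    rw [tsum_fintype, Finset.sum_const, Finset.card_univ, nsmul_eq_mul,
      ENNReal.mul_rpow_of_nonneg _ _ (by positivity), ← ENNReal.rpow_mul,
      mul_one_div_cancel hp'.ne', ENNReal.rpow_one, ENNReal.toReal_inv, one_div]

theorem ellNorm_of_eq_zero_of_ne {ι : Type} {q : ℝ≥0∞} (hq : 0 < q) (a : ι → ℝ≥0∞) (j : ι)
    (h : ∀ i, i ≠ j → a i = 0) : ellNorm q a = a j := by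
  unfold ellNorm
  split_ifs with hqt
  · refine le_antisymm (iSup_le fun i => ?_) (le_iSup a j)
    by_cases hi : i = j
    · rw [hi]
    · rw [h i hi]; exact zero_le
  · have hq' : 0 < q.toReal := ENNReal.toReal_pos hq.ne' hqt
    rw [tsum_eq_single j fun i hi => by rw [h i hi, ENNReal.zero_rpow_of_pos hq'],
      ← ENNReal.rpow_mul, mul_one_div_cancel hq'.ne', ENNReal.rpow_one]

/-- The Besov norm of the vertices of a cube of one level does not depend on `p` and `q`. -/
theorem vertex_level_mem_besovClass {α M δ : ℝ} {p q : ℝ≥0∞} (hp : 0 < p) (hq : 0 < q) {j : ℕ}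
    (hδ : 0 ≤ δ) (h : (2 : ℝ) ^ ((j : ℝ) * (α + 1 / 2)) * δ ≤ M) (u : Finset Idx) :
    vertex (level j) δ u ∈ besovClass α p q M := by
  have habs : ∀ j' (k : Fin (2 ^ j')), ENNReal.ofReal |vertex (level j) δ u ⟨j', k⟩| =
      if j' = j then ENNReal.ofReal δ else 0 := by
    intro j' k
    unfold vertex
    simp only [mem_level]
    split_ifs <;> simp [abs_of_nonneg hδ]
  have hn : ∀ j', ellNorm p (fun k : Fin (2 ^ j') =>
      ENNReal.ofReal |vertex (level j) δ u ⟨j', k⟩|) =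
      (2 ^ j' : ℝ≥0∞) ^ (p⁻¹).toReal * if j' = j then ENNReal.ofReal δ else 0 := by
    intro j'
    simp_rw [habs]
    rw [ellNorm_const hp]
    simp
  change besovNorm α p q _ ≤ ENNReal.ofReal M
  unfold besovNorm
  simp_rw [hn]
  rw [ellNorm_of_eq_zero_of_ne hq _ j fun i hi => by simp [hi]]
  simp only [if_true]
  have e : (2 ^ j : ℝ≥0∞) ^ (p⁻¹).toReal = ENNReal.ofReal ((2 : ℝ) ^ ((j : ℝ) * (p⁻¹).toReal)) := by
    rw [Real.rpow_mul (by norm_num), Real.rpow_natCast,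
      ← ENNReal.ofReal_rpow_of_pos (by positivity), ENNReal.ofReal_pow (by norm_num)]
    norm_num
  rw [e, ← ENNReal.ofReal_mul (by positivity), ← ENNReal.ofReal_mul (by positivity)]
  refine ENNReal.ofReal_le_ofReal (le_trans (le_of_eq ?_) h)
  rw [← mul_assoc, ← Real.rpow_add (by norm_num)]
  congr 2
  unfold besovExponent
  ring

theorem zero_mem_besovClass {α M : ℝ} {p q : ℝ≥0∞} (hp : 0 < p) (hq : 0 < q) (hM : 0 ≤ M) :
    (0 : Coeff) ∈ besovClass α p q M := by
  have h := vertex_level_mem_besovClass (α := α) (M := M) (j := 0) hp hq le_rfl (by simpa) ∅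
  have e : vertex (level 0) 0 ∅ = 0 := by ext i; simp [vertex]
  rwa [e] at h

/-- The number of coefficients that a minimax estimator has to estimate, up to constants. -/
noncomputable def effectiveDim (α M σ : ℝ) (m : ℕ) : ℝ :=
  (M ^ 2 * m / σ ^ 2) ^ (1 / (2 * α + 1))

section Rates

variable {α M σ : ℝ} {m : ℕ}

theorem effectiveDim_pos (hM : 0 < M) (hσ : 0 < σ) (hm : 0 < m) : 0 < effectiveDim α M σ m := by
  have : (0 : ℝ) < m := Nat.cast_pos.2 hm
  unfold effectiveDim; positivity

theorem effectiveDim_rpow (hα : 0 < α) :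
    effectiveDim α M σ m ^ (2 * α + 1) = M ^ 2 * m / σ ^ 2 := by
  unfold effectiveDim
  rw [← Real.rpow_mul (by positivity), one_div_mul_cancel (by positivity), Real.rpow_one]

theorem centralizedRate_eq (hα : 0 < α) (hM : 0 < M) (hσ : 0 < σ) (hm : 0 < m) :
    centralizedRate α M σ m = effectiveDim α M σ m * (σ ^ 2 / m) := by
  have hm' : (0 : ℝ) < m := Nat.cast_pos.2 hm
  have hα' : 2 * α + 1 ≠ 0 := by positivity
  have e1 : M ^ 2 * m / σ ^ 2 = M ^ 2 * (σ ^ 2 / m)⁻¹ := by field_simp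
  have e2 : (2 * α / (2 * α + 1)) = -(1 / (2 * α + 1)) + 1 := by field_simp; ring
  have e3 : M ^ (2 / (2 * α + 1)) = (M ^ 2) ^ (1 / (2 * α + 1)) := by
    rw [← Real.rpow_natCast, ← Real.rpow_mul hM.le]; congr 1; push_cast; ring
  unfold centralizedRate effectiveDim
  rw [e1, Real.mul_rpow (by positivity) (by positivity), e2, Real.rpow_add (by positivity),
    Real.rpow_one, Real.inv_rpow (by positivity), Real.rpow_neg (by positivity), e3, mul_assoc]

theorem communicationRate_eq (hα : 0 < α) (hM : 0 < M) (hσ : 0 < σ) (hm : 0 < m) :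
    communicationRate α M σ m = effectiveDim α M σ m * m := by
  have hm' : (0 : ℝ) < m := Nat.cast_pos.2 hm
  have hα' : 2 * α + 1 ≠ 0 := by positivity
  have e1 : M ^ 2 * m / σ ^ 2 = (M / σ) ^ 2 * m := by field_simp
  have e2 : (2 * α + 2) / (2 * α + 1) = 1 / (2 * α + 1) + 1 := by field_simp; ring
  have e3 : (M / σ) ^ (2 / (2 * α + 1)) = ((M / σ) ^ 2) ^ (1 / (2 * α + 1)) := by
    rw [← Real.rpow_natCast, ← Real.rpow_mul (by positivity)]; congr 1; push_cast; ring
  unfold communicationRate effectiveDim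
  rw [e1, Real.mul_rpow (by positivity) (by positivity), e2, Real.rpow_add hm', Real.rpow_one, e3,
    mul_assoc]

theorem effectiveDim_le {C : ℝ} (hα : 0 < α) (hM : 0 < M) (hσ : 0 < σ)
    (hm : 0 < m) (h : M ≤ C * σ * (m : ℝ) ^ (2 * α + 1 / 2)) :
    effectiveDim α M σ m ≤ (C ^ 2) ^ (1 / (2 * α + 1)) * m ^ 2 := by
  have hm' : (0 : ℝ) < m := Nat.cast_pos.2 hm
  have h1 : M ^ 2 * m / σ ^ 2 ≤ C ^ 2 * ((m : ℝ) ^ 2) ^ (2 * α + 1) := by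
    have h2 := pow_le_pow_left₀ hM.le h 2
    have e : ((m : ℝ) ^ (2 * α + 1 / 2)) ^ 2 * m = ((m : ℝ) ^ 2) ^ (2 * α + 1) := by
      rw [← Real.rpow_natCast, ← Real.rpow_mul hm'.le, ← Real.rpow_add_one hm'.ne',
        ← Real.rpow_natCast, ← Real.rpow_mul hm'.le]
      congr 1; push_cast; ring
    rw [div_le_iff₀ (by positivity), ← e]
    nlinarith [mul_le_mul_of_nonneg_right h2 hm'.le]
  calc effectiveDim α M σ m ≤ (C ^ 2 * ((m : ℝ) ^ 2) ^ (2 * α + 1)) ^ (1 / (2 * α + 1)) := by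
        unfold effectiveDim
        exact Real.rpow_le_rpow (by positivity) h1 (by positivity)
    _ = _ := by
        rw [Real.mul_rpow (by positivity) (by positivity), ← Real.rpow_mul (by positivity),
          mul_one_div_cancel (by positivity), Real.rpow_one]

end Rates

namespace DistributedEstimator

variable {m : ℕ}

/-- Minimax rate optimality forces long words over a suitable cube inside the Besov class. -/
theorem exists_cube_of_minimax (C α : ℝ) (hC : 0 < C) (hα : 0 < α) :
    ∃ β N η : ℝ, 0 < β ∧ 0 < N ∧ 0 < η ∧
      ∀ (m : ℕ) (σ M : ℝ) (p q : ℝ≥0∞) (T : DistributedEstimator m),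
        0 < m → 0 < σ → 0 < M → 0 < p → 0 < q →
        (⨆ θ ∈ besovClass α p q M, T.risk σ θ) ≤ ENNReal.ofReal (C * centralizedRate α M σ m) →
        N ≤ effectiveDim α M σ m →
        ∃ (I : Finset Idx) (δ : ℝ), 0 < δ ∧ δ ^ 2 = β * σ ^ 2 / m ∧
          (I.card : ℝ) ≤ effectiveDim α M σ m ∧ (∀ u, vertex I δ u ∈ besovClass α p q M) ∧
          2 ^ I.card * (η * m) ≤ ∑ u ∈ I.powerset, ∑ i, (T.wordLaw σ (vertex I δ u) i).real
            {z | effectiveDim α M σ m / N < z.length} := by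
  -- the signal is made stronger than the critical one until the risk bound becomes informative
  set b : ℝ := max 1 ((16 * C) ^ (1 / (2 * α))) with hb
  have hb1 : 1 ≤ b := le_max_left _ _
  have hb0 : 0 < b := by linarith
  have hbC : 16 * C ≤ b ^ (2 * α) := by
    calc 16 * C = ((16 * C) ^ (1 / (2 * α))) ^ (2 * α) := by
          rw [← Real.rpow_mul (by positivity), one_div_mul_cancel (by positivity), Real.rpow_one]
      _ ≤ b ^ (2 * α) := Real.rpow_le_rpow (by positivity) (le_max_right _ _) (by positivity)
  set β : ℝ := b ^ (2 * α + 1) with hβ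
  have hβ1 : 1 ≤ β := Real.one_le_rpow hb1 (by positivity)
  have hβ0 : 0 < β := by linarith
  have hβb : β = b ^ (2 * α) * b := by rw [hβ, Real.rpow_add_one hb0.ne']
  set κ : ℝ := 4 * Real.exp (4 * β) with hκ
  have hκ1 : 1 ≤ κ := by
    have := Real.one_le_exp (show 0 ≤ 4 * β by positivity)
    linarith
  set s : ℝ := 384 * Real.exp κ * β with hs
  set N : ℝ := 2 * b * (64 * κ * β) with hN
  have hκβ : 1 ≤ κ * β := one_le_mul_of_one_le_of_one_le hκ1 hβ1
  refine ⟨β, N, 1 / (16 * β * s), hβ0, by positivity, by positivity, ?_⟩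
  intro m σ M p q T hm hσ hM hp hq hrisk hE
  set E := effectiveDim α M σ m with hEdef
  have hE0 : 0 < E := effectiveDim_pos hM hσ hm
  have hm' : (0 : ℝ) < m := Nat.cast_pos.2 hm
  have hEb : 1 ≤ E / b := by
    rw [le_div_iff₀ hb0]; nlinarith
  obtain ⟨j, hj1, hj2⟩ := exists_nat_pow_near hEb one_lt_two
  rw [pow_succ, div_lt_iff₀ hb0] at hj2
  have hcard : ((level j).card : ℝ) = 2 ^ j := by rw [card_level]; push_cast; rfl
  set δ : ℝ := √(β * σ ^ 2 / m) with hδ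
  have hδ0 : 0 < δ := by positivity
  have hδ2 : δ ^ 2 = β * σ ^ 2 / m := Real.sq_sqrt (by positivity)
  have hclass : ∀ u, vertex (level j) δ u ∈ besovClass α p q M := by
    refine vertex_level_mem_besovClass hp hq hδ0.le
      ((le_abs_self _).trans (abs_le_of_sq_le_sq ?_ hM.le))
    have e1 : ((2 : ℝ) ^ ((j : ℝ) * (α + 1 / 2))) ^ 2 = ((2 : ℝ) ^ j) ^ (2 * α + 1) := by
      rw [← Real.rpow_natCast, ← Real.rpow_mul (by norm_num), ← Real.rpow_natCast (2 : ℝ) j,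
        ← Real.rpow_mul (by norm_num)]
      congr 1; push_cast; ring
    have e2 : ((2 : ℝ) ^ j) ^ (2 * α + 1) ≤ M ^ 2 * m / σ ^ 2 / β := by
      rw [← effectiveDim_rpow (M := M) (σ := σ) (m := m) hα, hβ, ← Real.div_rpow hE0.le hb0.le]
      exact Real.rpow_le_rpow (by positivity) hj1 (by positivity)
    rw [mul_pow, e1, hδ2]
    calc _ ≤ M ^ 2 * m / σ ^ 2 / β * (β * σ ^ 2 / m) := by gcongr
      _ = M ^ 2 := by field_simp
  have hr : ∀ u ⊆ level j, T.risk σ (vertex (level j) δ u) ≤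
      ENNReal.ofReal ((level j).card * δ ^ 2 / 8) := by
    intro u _
    have h1 := (le_iSup₂ (f := fun θ (_ : θ ∈ besovClass α p q M) => T.risk σ θ) _ (hclass u)).trans
      hrisk
    refine h1.trans (ENNReal.ofReal_le_ofReal ?_)
    rw [centralizedRate_eq hα hM hσ hm, hcard, hδ2, hβb]
    have e1 : C * E ≤ 2 ^ j * (b ^ (2 * α) * b) / 8 := by
      have := mul_le_mul_of_nonneg_right hbC hE0.le
      have := mul_le_mul_of_nonneg_left hj2.le (show 0 ≤ b ^ (2 * α) by positivity)
      linarith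
    calc C * (E * (σ ^ 2 / m)) = C * E * (σ ^ 2 / m) := by ring
      _ ≤ 2 ^ j * (b ^ (2 * α) * b) / 8 * (σ ^ 2 / m) := by gcongr
      _ = _ := by ring
  have hdim : 64 * κ * β ≤ ((level j).card : ℝ) := by
    rw [hcard]
    have : 2 * b * (64 * κ * β) < 2 * b * 2 ^ j := by rw [← hN]; linarith
    exact (lt_of_mul_lt_mul_left this (by positivity)).le
  refine ⟨level j, δ, hδ0, hδ2, ?_, hclass, ?_⟩
  · rw [hcard]
    exact hj1.trans (div_le_self hE0.le hb1)
  · have h := T.le_sum_prob_long_of_risk_le hm hσ (level j) hβ0 hκ hs hδ0 hδ2 hdim hr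
    refine le_trans (le_of_eq (by ring)) (h.trans ?_)
    refine Finset.sum_le_sum fun u _ => Finset.sum_le_sum fun i _ => measureReal_mono fun z hz => ?_
    refine lt_of_le_of_lt ?_ (Set.mem_ofPred.1 hz)
    rw [hcard, hN, div_le_div_iff₀ (by positivity) (by positivity)]
    have : E ≤ 2 ^ j * (2 * b) := by linarith
    nlinarith [mul_le_mul_of_nonneg_right this (show 0 ≤ 64 * κ * β by positivity)]

/-- The communication that is necessary over a Besov class for rate optimality over the same
class. -/
theorem communicationRate_le_iSup_expectedCommunication (C α : ℝ) (hC : 0 < C) (hα : 0 < α) :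
    ∃ c : ℝ, 0 < c ∧ ∀ (m : ℕ) (σ M : ℝ) (p q : ℝ≥0∞) (T : DistributedEstimator m),
      0 < m → 0 < σ → 0 < M → 0 < p → 0 < q →
      (⨆ θ ∈ besovClass α p q M, T.risk σ θ) ≤ ENNReal.ofReal (C * centralizedRate α M σ m) →
      ENNReal.ofReal (c * communicationRate α M σ m) ≤
        ⨆ θ ∈ besovClass α p q M, T.expectedCommunication σ θ := by
  obtain ⟨β, N, η, hβ, hN, hη, H⟩ := exists_cube_of_minimax C α hC hα
  refine ⟨min 1 η / N, by positivity, ?_⟩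
  intro m σ M p q T hm hσ hM hp hq hrisk
  have hm' : (0 : ℝ) < m := Nat.cast_pos.2 hm
  rw [communicationRate_eq hα hM hσ hm]
  set E := effectiveDim α M σ m with hE
  have hE0 : 0 < E := effectiveDim_pos hM hσ hm
  rcases lt_or_ge E N with h | h
  · refine le_trans ?_ (le_iSup₂ (f := fun θ (_ : θ ∈ besovClass α p q M) =>
      T.expectedCommunication σ θ) 0 (zero_mem_besovClass hp hq hM.le))
    refine le_trans ?_ (T.machines_le_expectedCommunication σ 0)
    rw [← ENNReal.ofReal_natCast]
    refine ENNReal.ofReal_le_ofReal ?_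
    calc min 1 η / N * (E * m) ≤ 1 / N * (N * m) := by gcongr; exact min_le_left _ _
      _ = m := by field_simp
  · obtain ⟨I, δ, hδ, hδ2, hI, hcl, hsum⟩ := H m σ M p q T hm hσ hM hp hq hrisk h
    have hcard : ∑ u ∈ I.powerset, η * (m : ℝ) = 2 ^ I.card * (η * m) := by
      rw [Finset.sum_const, Finset.card_powerset, nsmul_eq_mul]; push_cast; rfl
    rw [← hcard] at hsum
    obtain ⟨u, -, hu⟩ := Finset.exists_le_of_sum_le ⟨∅, Finset.empty_mem_powerset I⟩ hsum
    refine le_trans ?_ (le_iSup₂ (f := fun θ (_ : θ ∈ besovClass α p q M) =>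
      T.expectedCommunication σ θ) _ (hcl u))
    refine le_trans (ENNReal.ofReal_le_ofReal ?_)
      (T.mul_sum_prob_long_le σ _ (t := E / N) (by positivity))
    calc min 1 η / N * (E * m) ≤ η / N * (E * m) := by gcongr; exact min_le_right _ _
      _ = E / N * (η * m) := by ring
      _ ≤ _ := by gcongr

/-- The communication that is necessary at the zero sequence for rate optimality over a Besov
class that is not too large: single machines cannot recognize the zero sequence. -/
theorem communicationRate_le_expectedCommunication_zero (C α : ℝ) (hC : 0 < C) (hα : 0 < α) :
    ∃ c : ℝ, 0 < c ∧ ∀ (m : ℕ) (σ M : ℝ) (p q : ℝ≥0∞) (T : DistributedEstimator m),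
      0 < m → 0 < σ → 0 < M → 0 < p → 0 < q → M ≤ C * σ * (m : ℝ) ^ (2 * α + 1 / 2) →
      (⨆ θ ∈ besovClass α p q M, T.risk σ θ) ≤ ENNReal.ofReal (C * centralizedRate α M σ m) →
      ENNReal.ofReal (c * communicationRate α M σ m) ≤ T.expectedCommunication σ 0 := by
  obtain ⟨β, N, η, hβ, hN, hη, H⟩ := exists_cube_of_minimax C α hC hα
  set Λ : ℝ := Real.exp ((C ^ 2) ^ (1 / (2 * α + 1)) * β ^ 2 / 2) with hΛ
  have hΛ0 : 0 < Λ := Real.exp_pos _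
  refine ⟨min 1 (η ^ 2 / (4 * Λ)) / N, by positivity, ?_⟩
  intro m σ M p q T hm hσ hM hp hq hMm hrisk
  have hm' : (0 : ℝ) < m := Nat.cast_pos.2 hm
  rw [communicationRate_eq hα hM hσ hm]
  have hEm := effectiveDim_le hα hM hσ hm hMm
  set E := effectiveDim α M σ m with hE
  have hE0 : 0 < E := effectiveDim_pos hM hσ hm
  rcases lt_or_ge E N with h | h
  · refine le_trans ?_ (T.machines_le_expectedCommunication σ 0)
    rw [← ENNReal.ofReal_natCast]
    refine ENNReal.ofReal_le_ofReal ?_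
    calc min 1 (η ^ 2 / (4 * Λ)) / N * (E * m) ≤ 1 / N * (N * m) := by
          gcongr; exact min_le_left _ _
      _ = m := by field_simp
  · obtain ⟨I, δ, hδ, hδ2, hI, -, hsum⟩ := H m σ M p q T hm hσ hM hp hq hrisk h
    set A : Set (List Bool) := {z | E / N < z.length} with hA
    have hexp : Real.exp (I.card * δ ^ 4 / (2 * σ ^ 4)) ≤ Λ := by
      refine Real.exp_le_exp.2 ?_
      have e : I.card * δ ^ 4 / (2 * σ ^ 4) = I.card * (β ^ 2 / m ^ 2 / 2) := by
        have : δ ^ 4 = (δ ^ 2) ^ 2 := by ring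
        rw [this, hδ2]; field_simp
      rw [e]
      calc _ ≤ (C ^ 2) ^ (1 / (2 * α + 1)) * m ^ 2 * (β ^ 2 / m ^ 2 / 2) := by
            gcongr; exact hI.trans hEm
        _ = _ := by field_simp
    -- the weight that balances the two terms of `sum_vertex_prob_le`
    set w : ℝ := 2 * Λ / η with hw
    have hw0 : 0 < w := by positivity
    rw [Finset.sum_comm] at hsum
    have h1 := hsum.trans (Finset.sum_le_sum fun i _ => T.sum_vertex_prob_le hσ I δ i A hw0)
    rw [← Finset.mul_sum, Finset.sum_add_distrib, ← Finset.mul_sum, Finset.sum_const,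
      Finset.card_univ, Fintype.card_fin, nsmul_eq_mul] at h1
    have h2 := le_of_mul_le_mul_left h1 (by positivity)
    set X := ∑ i, (T.wordLaw σ 0 i).real A with hX
    have h3 : m * (Real.exp (I.card * δ ^ 4 / (2 * σ ^ 4)) / w) ≤ η * m / 2 := by
      calc _ ≤ m * (Λ / w) := by gcongr
        _ = _ := by rw [hw]; field_simp
    have h4 : η ^ 2 / (4 * Λ) * m ≤ X := by
      have h5 : η * m / 2 ≤ w * X := by linarith
      have h6 : η ^ 2 / (4 * Λ) * m = η * m / 2 / w := by rw [hw]; field_simp; ring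
      rw [h6, div_le_iff₀ hw0]; linarith
    refine le_trans (ENNReal.ofReal_le_ofReal ?_)
      (T.mul_sum_prob_long_le σ 0 (t := E / N) (by positivity))
    calc min 1 (η ^ 2 / (4 * Λ)) / N * (E * m) ≤ η ^ 2 / (4 * Λ) / N * (E * m) := by
          gcongr; exact min_le_right _ _
      _ = E / N * (η ^ 2 / (4 * Λ) * m) := by ring
      _ ≤ _ := by gcongr

end DistributedEstimator

end DistributedSequence

/-! ### The lower bound -/

theorem theorem4 (C α₁ α₂ : ℝ) (hC : 0 < C) (hα₁ : 0 < α₁) (hα₂ : 0 < α₂) :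
    ∃ c : ℝ, 0 < c ∧
      ∀ (m : ℕ) (σ M₁ M₂ : ℝ) (p₁ q₁ p₂ q₂ : ℝ≥0∞)
        (T : DistributedSequence.DistributedEstimator m),
        0 < m → 0 < σ → 0 < M₁ → 0 < M₂ →
        0 < p₁ → 0 < q₁ → 0 < p₂ → 0 < q₂ →
        0 < DistributedSequence.besovExponent α₁ p₁ →
        0 < DistributedSequence.besovExponent α₂ p₂ →
        M₁ ≤ C * σ * (m : ℝ) ^ (2 * α₁ + 1 / 2) →
        (⨆ θ ∈ DistributedSequence.besovClass α₁ p₁ q₁ M₁, T.risk σ θ) ≤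
          ENNReal.ofReal (C * DistributedSequence.centralizedRate α₁ M₁ σ m) →
        (⨆ θ ∈ DistributedSequence.besovClass α₂ p₂ q₂ M₂, T.risk σ θ) ≤
          ENNReal.ofReal (C * DistributedSequence.centralizedRate α₂ M₂ σ m) →
        ENNReal.ofReal (c * (DistributedSequence.communicationRate α₁ M₁ σ m +
            DistributedSequence.communicationRate α₂ M₂ σ m)) ≤
          ⨆ θ ∈ DistributedSequence.besovClass α₂ p₂ q₂ M₂, T.expectedCommunication σ θ := by
  obtain ⟨c₁, hc₁, H₁⟩ :=
    DistributedSequence.DistributedEstimator.communicationRate_le_expectedCommunication_zero C α₁ hC hα₁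
  obtain ⟨c₂, hc₂, H₂⟩ :=
    DistributedSequence.DistributedEstimator.communicationRate_le_iSup_expectedCommunication C α₂ hC hα₂
  refine ⟨min c₁ c₂ / 2, by positivity, ?_⟩
  intro m σ M₁ M₂ p₁ q₁ p₂ q₂ T hm hσ hM₁ hM₂ hp₁ hq₁ hp₂ hq₂ _ _ hM hr₁ hr₂
  have h₁ := (H₁ m σ M₁ p₁ q₁ T hm hσ hM₁ hp₁ hq₁ hM hr₁).trans
    (le_iSup₂ (f := fun θ (_ : θ ∈ DistributedSequence.besovClass α₂ p₂ q₂ M₂) =>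
      T.expectedCommunication σ θ) 0 (DistributedSequence.zero_mem_besovClass hp₂ hq₂ hM₂.le))
  have h₂ := H₂ m σ M₂ p₂ q₂ T hm hσ hM₂ hp₂ hq₂ hr₂
  have hR₁ : 0 ≤ DistributedSequence.communicationRate α₁ M₁ σ m := by
    unfold DistributedSequence.communicationRate; positivity
  have hR₂ : 0 ≤ DistributedSequence.communicationRate α₂ M₂ σ m := by
    unfold DistributedSequence.communicationRate; positivity
  refine le_trans ?_ (max_le h₁ h₂)
  rw [← ENNReal.ofReal_max]
  refine ENNReal.ofReal_le_ofReal ?_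
  have e₁ := mul_le_mul_of_nonneg_right (min_le_left c₁ c₂) hR₁
  have e₂ := mul_le_mul_of_nonneg_right (min_le_right c₁ c₂) hR₂
  linarith [le_max_left (c₁ * DistributedSequence.communicationRate α₁ M₁ σ m)
      (c₂ * DistributedSequence.communicationRate α₂ M₂ σ m),
    le_max_right (c₁ * DistributedSequence.communicationRate α₁ M₁ σ m)
      (c₂ * DistributedSequence.communicationRate α₂ M₂ σ m)]
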